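/- **Theorem (Generalized Kruppa's equations).** Let $X\subset\mathbb P^3$ be a smooth irreducible algebraic curve over $\mathbb C$ that is not contained in a plane. For a generic position of the pair of camera centers $(\mathbf O_1,\mathbf O_2)$, i.e. for all pairs in some nonempty Zariski open set of pairs of points of $\mathbb P^3$ that depends only on $X$, the following holds for all camera matrices $\mathbf M_1,\mathbf M_2$ ($3\times4$ complex matrices of rank $3$) with $\mathbf M_i\mathbf O_i=\mathbf 0$. Let $Y_i\subset\mathbb P^2$ be the image of $X$ under $\mathbf P\mapsto \mathbf M_i\mathbf P$, and let $Y_i^\star$ be its dual curve, i.e. the Zariski closure in the dual plane of the set of tangent lines to $Y_i$ at smooth points. The ideal of all polynomials vanishing on $Y_i^\star$ is principal; let $\phi_i$ be any generator of it (the polynomial of $Y_i^\star$, unique up to a nonzero scalar). Let $\mathbf e_1\sim\mathbf M_1\mathbf O_2$ and $\mathbf e_2\sim\mathbf M_2\mathbf O_1$ be coordinate vectors of the epipoles, and let $\mathbf F$ be a fundamental matrix: a $3\times3$ matrix such that for each point $\mathbf p\neq\mathbf e_1$ of the first image the line with coordinates $\mathbf F\mathbf p$ is the image under $\mathbf M_2$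 of the optical ray of $\mathbf p$ (the line of all $\mathbf P$ with $\mathbf M_1\mathbf P$ proportional to $\mathbf p$). Write $\mathbf e_1\vee\mathbf p=\mathbf e_1\times\mathbf p$ for the line joining $\mathbf e_1$ and $\mathbf p$. Then: 1. There is a nonzero scalar $\lambda$ such that $\phi_2(\mathbf F\mathbf p)=\lambda\,\phi_1(\mathbf e_1\vee\mathbf p)$ for all $\mathbf p\in\mathbb C^3$. 2. The epipolar tangent lines in the two images correspond projectively, with matching multiplicities: $\mathbf e_1\vee\mathbf p\mapsto\mathbf F\mathbf p$ defines a linear isomorphism $h$ from the space of coordinate vectors of lines through $\mathbf e_1$ to that of lines through $\mathbf e_2$, and for every line $\mathbf l$ through $\mathbf e_1$: $\mathbf l\in Y_1^\star$ if and only if $h(\mathbf l)\in Y_2^\star$; the multiplicity of $\mathbf l$ as a point of the curve $\phi_1=0$ equals that of $h(\mathbf l)$ as a point of $\phi_2=0$; and for every line $\mathbf k$ through $\mathbf e_1$ the orders of vanishing at $t=0$ of $\phi_1(\mathbf l+t\mathbf k)$ and $\phi_2(h(\mathbf l)+t\,h(\mathbf k))$ are equal, so the intersection multiplicities of the dual curves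 with the two pencils of epipolar lines agree as well. -/

import Mathlib

open scoped Matrix LinearAlgebra.Projectivization

noncomputable section

namespace Kruppa

/-! ### Projective algebraic sets over `ℂ` -/

/-- Points of complex projective space of dimension `n - 1`, with `n` homogeneous coordinates. -/
abbrev Proj (n : ℕ) : Type := ℙ ℂ (Fin n → ℂ)

/-- All nonzero homogeneous coordinate vectors of the points of `S`. -/
def coords {n : ℕ} (S : Set (Proj n)) : Set (Fin n → ℂ) :=
  {v | ∃ hv : v ≠ 0, Projectivization.mk ℂ v hv ∈ S}

/-- The ideal of all polynomials that vanish on `S`. -/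
def idealOf {n : ℕ} (S : Set (Proj n)) : Ideal (MvPolynomial (Fin n) ℂ) :=
  MvPolynomial.vanishingIdeal ℂ (coords S)

/-- The Zariski closure of `S`: the common zeros of the polynomials vanishing on `S`. -/
def zariskiClosure {n : ℕ} (S : Set (Proj n)) : Set (Proj n) :=
  {P | ∀ f ∈ idealOf S, ∀ (v : Fin n → ℂ) (hv : v ≠ 0),
    Projectivization.mk ℂ v hv = P → MvPolynomial.eval v f = 0}

/-- The gradient of `f` at `v`. -/
def gradient {n : ℕ} (f : MvPolynomial (Fin n) ℂ) (v : Fin n → ℂ) : Fin n → ℂ :=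
  fun i => MvPolynomial.eval v (MvPolynomial.pderiv i f)

/-- The span of the gradients at `v` of all polynomials vanishing on `S`: the linear equations
of the projective tangent space of `S` at the point with coordinates `v`. -/
def conormal {n : ℕ} (S : Set (Proj n)) (v : Fin n → ℂ) : Submodule ℂ (Fin n → ℂ) :=
  Submodule.span ℂ {w | ∃ f ∈ idealOf S, w = gradient f v}

/-- `X` is a smooth irreducible curve in projective 3-space. -/
structure IsSmoothSpaceCurve (X : Set (Proj 4)) : Prop where
  /-- `X` is Zariski closed. -/
  closed : zariskiClosure X = X
  /-- `X` is irreducible (and non-empty). -/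
  irreducible : (idealOf X).IsPrime
  /-- `X` has dimension one: its homogeneous coordinate ring has dimension two. -/
  dim_one : ringKrullDim (MvPolynomial (Fin 4) ℂ ⧸ idealOf X) = 2
  /-- Jacobian criterion: the tangent space is a line at every point of `X`. -/
  smooth : ∀ v ∈ coords X, Module.finrank ℂ (conormal X v) = 2

/-- `X` lies in no plane. -/
def IsNonPlanar (X : Set (Proj 4)) : Prop :=
  ∀ a : Fin 4 → ℂ, a ≠ 0 → ∃ v ∈ coords X, a ⬝ᵥ v ≠ 0

/-- `φ` is the polynomial of the hypersurface `S`: it generates the ideal of `S`. It is then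
unique up to a nonzero scalar. -/
def IsDefiningPolynomial {n : ℕ} (φ : MvPolynomial (Fin n) ℂ) (S : Set (Proj n)) : Prop :=
  Ideal.span {φ} = idealOf S

/-! ### Plane curves and their duals -/

/-- The lines that are tangent to the plane curve `Y` at a smooth point of `Y`; the line
`l 0 * x + l 1 * y + l 2 * z = 0` is given by its coordinates `l`. A point is smooth when the
gradients there of the polynomials vanishing on `Y` span a space of dimension one. -/
def tangentLines (Y : Set (Proj 3)) : Set (Proj 3) :=
  {L | ∃ v ∈ coords Y, ∃ (l : Fin 3 → ℂ) (hl : l ≠ 0),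
    conormal Y v = Submodule.span ℂ {l} ∧ L = Projectivization.mk ℂ l hl}

/-- The dual curve of `Y`: the closure of the set of its tangent lines at smooth points. -/
def dualCurve (Y : Set (Proj 3)) : Set (Proj 3) :=
  zariskiClosure (tangentLines Y)

/-- The order of vanishing at `t = 0` of `φ (l + t k)`, which is `⊤` if this vanishes
identically. If `k` is not a multiple of `l`, it is the intersection multiplicity at `l` of the
curve `φ = 0` with the line joining the points `l` and `k`. -/
def orderAlong {n : ℕ} (φ : MvPolynomial (Fin n) ℂ) (l k : Fin n → ℂ) : ℕ∞ :=
  emultiplicity (Polynomial.X : Polynomial ℂ)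
    (MvPolynomial.aeval (fun i => Polynomial.C (l i) + Polynomial.X * Polynomial.C (k i)) φ)

/-- The multiplicity of the point `l` on the hypersurface `φ = 0`: the order of vanishing of `φ`
at `l`, which is the least order along a direction. It is `0` off the hypersurface. -/
def pointMultiplicity {n : ℕ} (φ : MvPolynomial (Fin n) ℂ) (l : Fin n → ℂ) : ℕ∞ :=
  ⨅ k : Fin n → ℂ, orderAlong φ l k

/-! ### Cameras -/

/-- `M` is a camera matrix with camera center `O`: the projection is `P ↦ M P`, a map defined
away from `O`. -/
def IsCamera (M : Matrix (Fin 3) (Fin 4) ℂ) (O : Fin 4 → ℂ) : Prop :=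
  M.rank = 3 ∧ O ≠ 0 ∧ M *ᵥ O = 0

/-- The image of `X` by the camera `M`. -/
def imageCurve (M : Matrix (Fin 3) (Fin 4) ℂ) (X : Set (Proj 4)) : Set (Proj 3) :=
  {Q | ∃ v ∈ coords X, ∃ h : M *ᵥ v ≠ 0, Q = Projectivization.mk ℂ (M *ᵥ v) h}

/-- `e` is a coordinate vector of the epipole in the image of the camera `M`, where `O'` is the
center of the other camera: the image of the baseline, that is, of the point `O'`. -/
def IsEpipole (M : Matrix (Fin 3) (Fin 4) ℂ) (O' : Fin 4 → ℂ) (e : Fin 3 → ℂ) : Prop :=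
  e ≠ 0 ∧ ∃ c : ℂ, e = c • (M *ᵥ O')

/-- `F` is a fundamental matrix of `(M₁, M₂)`: for every point `p` of the first image other than
the first epipole `e₁`, the image by `M₂` of the optical ray of `p` (all the `P` with `M₁ P`
proportional to `p`) is the line with coordinates `F p`. -/
def IsFundamentalMatrix (M₁ M₂ : Matrix (Fin 3) (Fin 4) ℂ) (e₁ : Fin 3 → ℂ)
    (F : Matrix (Fin 3) (Fin 3) ℂ) : Prop :=
  ∀ p : Fin 3 → ℂ, p ∉ Submodule.span ℂ {e₁} → ∀ q : Fin 3 → ℂ,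
    q ∈ ((Submodule.span ℂ {p}).comap M₁.mulVecLin).map M₂.mulVecLin ↔ (F *ᵥ p) ⬝ᵥ q = 0

/-- The pencil of lines through the point `e`, as a space of line coordinates. -/
def pencil (e : Fin 3 → ℂ) : Submodule ℂ (Fin 3 → ℂ) where
  carrier := {l | l ⬝ᵥ e = 0}
  zero_mem' := by simp
  add_mem' := by
    intro a b ha hb
    change a ⬝ᵥ e = 0 at ha
    change b ⬝ᵥ e = 0 at hb
    change (a + b) ⬝ᵥ e = 0
    rw [add_dotProduct, ha, hb, add_zero]
  smul_mem' := by
    intro c a ha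
    change a ⬝ᵥ e = 0 at ha
    change (c • a) ⬝ᵥ e = 0
    rw [smul_dotProduct, ha, smul_zero]

/-- `C` holds for a generic position of the two camera centers: for all pairs of centers in the
nonempty Zariski open set defined by some nonzero polynomial `G` in their coordinates. -/
def ForGenericCenters (C : (Fin 4 → ℂ) → (Fin 4 → ℂ) → Prop) : Prop :=
  ∃ G : MvPolynomial (Fin 4 ⊕ Fin 4) ℂ, G ≠ 0 ∧ ∀ O₁ O₂ : Fin 4 → ℂ,
    O₁ ≠ 0 → O₂ ≠ 0 → MvPolynomial.eval (Sum.elim O₁ O₂) G ≠ 0 → C O₁ O₂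

/-- The lines of the pencils through `e₁` and `e₂` that are tangent to `Y₁` and `Y₂` correspond
under the projective isomorphism of pencils `e₁ ∨ p ↦ F p`, with equal multiplicities, both as
points of the dual curves `φ₁ = 0` and `φ₂ = 0` and as intersections of the dual curves with the
pencils. -/
def EpipolarTangentsCorrespond (Y₁ Y₂ : Set (Proj 3)) (φ₁ φ₂ : MvPolynomial (Fin 3) ℂ)
    (e₁ e₂ : Fin 3 → ℂ) (F : Matrix (Fin 3) (Fin 3) ℂ) : Prop :=
  ∃ h : pencil e₁ ≃ₗ[ℂ] pencil e₂,
    (∀ (l : pencil e₁) (p : Fin 3 → ℂ), (l : Fin 3 → ℂ) = e₁ ⨯₃ p →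
      (h l : Fin 3 → ℂ) = F *ᵥ p) ∧
    ∀ l : pencil e₁, l ≠ 0 →
      ((l : Fin 3 → ℂ) ∈ coords (dualCurve Y₁) ↔ (h l : Fin 3 → ℂ) ∈ coords (dualCurve Y₂)) ∧
      pointMultiplicity φ₁ l = pointMultiplicity φ₂ (h l) ∧
      ∀ k : pencil e₁, orderAlong φ₁ l k = orderAlong φ₂ (h l) (h k)

end Kruppa

end

noncomputable section

namespace Kruppa

open MvPolynomial

/-! ### Commutative algebra -/

/-! Both dual curves are plane sections of one surface. The planes containing a tangent line of `X`
form the dual surface, whose ideal `dualIdeal X` is prime, nonzero because the surface is swept out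
by a one-parameter family of pencils, and, as `X` is nonplanar, strictly smaller than the ideal of a
single such pencil. Counting dimensions, it is generated by one irreducible form `Φ`
(`exists_dualIdeal_eq_span`).

A line `l` of the image is seen from the center `O` along the plane `Mᵀ l`. If `O` is on no tangent
line of `X`, then `l` lies on the dual curve of the image exactly when `Mᵀ l` is tangent to `X`.
Hence `φ` is a scalar multiple of `Φ ∘ Mᵀ`, provided the latter is squarefree (`idealOf_dualCurve`).
This uses the closedness of the set of tangent planes (`exists_mem_conormal`) and the
Nullstellensatz.

The lines `e₁ ∨ p` and `F p` are seen along the same plane through both centers, so `M₂ᵀ F p = κ M₁ᵀ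
(e₁ × p)` with a constant `κ ≠ 0` (`IsFundamentalMatrix.exists_smul`). Applying `Φ` yields the first
claim, with scalar `c₂ κ ^ D / c₁`, and the equality of orders along the pencils.

Genericity means that the centers avoid the tangent lines and that the pencil of planes through them
meets the dual surface transversally (`exists_generic_pencil`). Transversality makes both sections
squarefree and makes every epipolar tangent a simple point of its dual curve, which settles the
point multiplicities. -/

theorem ringKrullDim_le_of_isIntegral {R S : Type*} [CommRing R] [CommRing S] [Algebra R S]
    [Algebra.IsIntegral R S] (h : Function.Injective (algebraMap R S)) :
    ringKrullDim R ≤ ringKrullDim S := by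
  refine iSup_le fun l => ?_
  have := (faithfulSMul_iff_algebraMap_injective R S).mpr h
  have hgu : Algebra.HasGoingUp R S := inferInstance
  obtain ⟨⟨P, hP⟩, hP'⟩ := Algebra.IsIntegral.comap_surjective R S l.head
  have : P.LiesOver l.head.asIdeal := ⟨by rw [← hP']; rfl⟩
  obtain ⟨L, hL, -⟩ := Ideal.exists_ltSeries_of_hasGoingUp l P
  rw [← hL]
  exact le_iSup (fun l : LTSeries (PrimeSpectrum S) => ((l.length : ℕ∞) : WithBot ℕ∞)) L

/-- A prime of `B` contracting to zero reduces to a domain. Noether normalization makes that domain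
integral over a polynomial ring in `s` variables; comparing transcendence degrees gives `n ≤ s`, and
integrality gives dimension at least `s`. -/
theorem natCast_le_ringKrullDim_of_injective {k B : Type*} [Field k] [CommRing B] [Algebra k B]
    [Algebra.FiniteType k B] {n : ℕ} (f : MvPolynomial (Fin n) k →ₐ[k] B)
    (hf : Function.Injective f) : (n : WithBot ℕ∞) ≤ ringKrullDim B := by
  obtain ⟨P, hP, hPf⟩ : ∃ P : Ideal B, P.IsPrime ∧ P.comap f = ⊥ := by
    refine Ideal.exists_comap_eq_of_mem_minimalPrimes_of_injective
      (f := (f : MvPolynomial (Fin n) k →+* B)) hf ⊥ ?_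
    simp [IsDomain.minimalPrimes_eq_singleton_bot]
  refine le_trans ?_ (ringKrullDim_quotient_le P)
  have hinj : Function.Injective ((Ideal.Quotient.mkₐ k P).comp f) := by
    rw [injective_iff_map_eq_zero]
    intro a ha
    have : a ∈ P.comap f := by simpa [Ideal.Quotient.eq_zero_iff_mem] using ha
    rwa [hPf] at this
  obtain ⟨s, g, hg, hgi⟩ := exists_integral_inj_algHom_of_fg k (B ⧸ P)
  have hns : n ≤ s := by
    let := g.toRingHom.toAlgebra
    have : IsScalarTower k (MvPolynomial (Fin s) k) (B ⧸ P) := .of_algebraMap_eq' (g.comp_algebraMap.symm)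
    have : Algebra.IsIntegral (MvPolynomial (Fin s) k) (B ⧸ P) := ⟨hgi⟩
    have : FaithfulSMul (MvPolynomial (Fin s) k) (B ⧸ P) := (faithfulSMul_iff_algebraMap_injective _ _).mpr hg
    have h1 := lift_trdeg_le_of_injective _ hinj
    have h2 := lift_trdeg_add_eq k (MvPolynomial (Fin s) k) (B ⧸ P)
    rw [(trdeg_eq_zero : Algebra.trdeg (MvPolynomial (Fin s) k) (B ⧸ P) = 0)] at h2
    simp [MvPolynomial.trdeg_of_isDomain] at h1 h2
    rw [← h2] at h1
    simpa using h1
  let := g.toRingHom.toAlgebra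
  have : Algebra.IsIntegral (MvPolynomial (Fin s) k) (B ⧸ P) := ⟨hgi⟩
  refine le_trans ?_ (ringKrullDim_le_of_isIntegral (R := MvPolynomial (Fin s) k) hg)
  simp [ringKrullDim_eq_zero_of_field]
  exact_mod_cast hns

theorem eval_smul_of_isHomogeneous {σ R : Type*} [CommRing R] {p : MvPolynomial σ R} {d : ℕ}
    (hp : p.IsHomogeneous d) (c : R) (x : σ → R) : eval (c • x) p = c ^ d * eval x p := by
  rw [eval_eq, eval_eq, Finset.mul_sum]
  refine Finset.sum_congr rfl fun m hm => ?_
  have : ∑ i ∈ m.support, m i = d := by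
    rw [← hp (mem_support_iff.mp hm), Finsupp.weight_apply]
    simp [Finsupp.sum]
  simp only [Pi.smul_apply, smul_eq_mul, mul_pow, Finset.prod_mul_distrib]
  rw [Finset.prod_pow_eq_pow_sum, this]
  ring

/-- The values of the components at `x` are the coefficients of `c ↦ p (c x)`, a polynomial with
infinitely many roots. -/
theorem eval_homogeneousComponent_eq_zero {σ : Type*} {p : MvPolynomial σ ℂ} {x : σ → ℂ}
    (h : ∀ c : ℂ, c ≠ 0 → eval (c • x) p = 0) (d : ℕ) :
    eval x (homogeneousComponent d p) = 0 := by
  let q : Polynomial ℂ := ∑ i ∈ Finset.range (p.totalDegree + 1),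
    Polynomial.monomial i (eval x (homogeneousComponent i p))
  have hq : q = 0 := by
    refine Polynomial.eq_zero_of_infinite_isRoot _ (Set.Infinite.mono (s := {0}ᶜ) (fun c hc => ?_)
      (Set.finite_singleton _).infinite_compl)
    have := h c hc
    rw [← sum_homogeneousComponent p, map_sum] at this
    simp only [q, Set.mem_ofPred_eq, Polynomial.IsRoot.def, Polynomial.eval_finsetSum,
      Polynomial.eval_monomial]
    rw [← this]
    refine Finset.sum_congr rfl fun i _ => ?_
    rw [eval_smul_of_isHomogeneous (homogeneousComponent_isHomogeneous i p)]
    simp [mul_comm]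
  by_cases hd : d < p.totalDegree + 1
  · have := congrArg (fun r => Polynomial.coeff r d) hq
    simpa [q, Polynomial.coeff_monomial, hd] using this
  · rw [homogeneousComponent_eq_zero _ _ (by omega), map_zero]

/-- Clearing denominators in `m (x / x i)` turns a condition on the representative with `i`-th
coordinate one into a polynomial condition on the whole cone. -/
theorem exists_dehomogenization {σ : Type*} (m : MvPolynomial σ ℂ) (i : σ) :
    ∃ (q : MvPolynomial σ ℂ) (N : ℕ), ∀ x : σ → ℂ, x i ≠ 0 → 
      eval x q = x i ^ N * eval ((x i)⁻¹ • x) m := by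
  refine ⟨∑ d ∈ Finset.range (m.totalDegree + 1), X i ^ (m.totalDegree - d) *
    homogeneousComponent d m, m.totalDegree, fun x hx => ?_⟩
  have hm : eval ((x i)⁻¹ • x) m = eval ((x i)⁻¹ • x)
      (∑ d ∈ Finset.range (m.totalDegree + 1), homogeneousComponent d m) := by
    rw [sum_homogeneousComponent]
  rw [hm, map_sum, map_sum, Finset.mul_sum]
  refine Finset.sum_congr rfl fun d hd => ?_
  rw [eval_smul_of_isHomogeneous (homogeneousComponent_isHomogeneous d m)]
  have : m.totalDegree = (m.totalDegree - d) + d := by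
    have := Finset.mem_range.mp hd
    omega
  conv_rhs => rw [this, pow_add]
  simp
  field_simp

theorem pderiv_aeval_linear {m n : ℕ} (M : Matrix (Fin m) (Fin n) ℂ) (f : MvPolynomial (Fin m) ℂ)
    (j : Fin n) :
    pderiv j (aeval (fun i => ∑ k, C (M i k) * X k) f : MvPolynomial (Fin n) ℂ) =
      ∑ i, C (M i j) * aeval (fun i => ∑ k, C (M i k) * X k) (pderiv i f) := by
  induction f using MvPolynomial.induction_on with
  | C a => simp
  | add p q hp hq => simp only [map_add, hp, hq, mul_add, Finset.sum_add_distrib]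
  | mul_X p i hp =>
    simp only [map_mul, aeval_X, Derivation.leibniz, hp, smul_eq_mul, map_add, pderiv_X, 
      mul_add, Finset.sum_add_distrib]
    congr 1
    · simp [pderiv_X, Pi.single_apply, mul_comm]
    · rw [Finset.mul_sum]
      exact Finset.sum_congr rfl fun _ _ => by ring

/-! ### The cross product of three vectors in four-space -/

/-- The vector representing the linear form `h ↦ det (h, u, v, w)`. -/
def cross4 {R : Type*} [CommRing R] (u v w : Fin 4 → R) : Fin 4 → R :=
  fun i => (Matrix.of ![Pi.single i 1, u, v, w]).det

theorem cross4_dotProduct {R : Type*} [CommRing R] (u v w h : Fin 4 → R) :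
    cross4 u v w ⬝ᵥ h = (Matrix.of ![h, u, v, w]).det := by
  simp [cross4, dotProduct, Matrix.det_succ_row_zero, Fin.sum_univ_succ, Pi.single_apply,
    Fin.succAbove]
  ring

theorem map_cross4 {R S : Type*} [CommRing R] [CommRing S] (f : R →+* S) (u v w : Fin 4 → R) :
    (fun i => f (cross4 u v w i)) = cross4 (f ∘ u) (f ∘ v) (f ∘ w) := by
  funext i
  simp [cross4, Matrix.det_succ_row_zero, Fin.sum_univ_succ, Pi.single_apply, Fin.succAbove]

theorem cross4_dotProduct_right {R : Type*} [CommRing R] (u v w : Fin 4 → R) :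
    cross4 u v w ⬝ᵥ w = 0 := by
  rw [cross4_dotProduct]
  exact Matrix.det_zero_of_row_eq (i := 0) (j := 3) (by decide) rfl

theorem cross4_dotProduct_middle {R : Type*} [CommRing R] (u v w : Fin 4 → R) :
    cross4 u v w ⬝ᵥ v = 0 := by
  rw [cross4_dotProduct]
  exact Matrix.det_zero_of_row_eq (i := 0) (j := 2) (by decide) rfl

theorem det_ne_zero_of_linearIndependent {u : Fin 4 → Fin 4 → ℂ} (h : LinearIndependent ℂ u) :
    (Matrix.of u).det ≠ 0 := by
  have : IsUnit (Matrix.of u) := Matrix.linearIndependent_rows_iff_isUnit.mp h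
  exact ((Matrix.isUnit_iff_isUnit_det _).mp this).ne_zero

theorem range_pair {α : Type*} (u v : α) : Set.range ![u, v] = {u, v} := by
  simp [Matrix.range_cons, Matrix.range_empty, Set.pair_comm]

theorem finrank_span_pair {n : ℕ} {u v : Fin n → ℂ} (h : LinearIndependent ℂ ![u, v]) :
    Module.finrank ℂ (Submodule.span ℂ {u, v}) = 2 := by
  have := finrank_span_eq_card h
  rwa [range_pair, Fintype.card_fin] at this

theorem exists_det_ne_zero {h u v : Fin 4 → ℂ} (huv : LinearIndependent ℂ ![u, v])
    (hh : h ∉ Submodule.span ℂ {u, v}) : ∃ c, (Matrix.of ![h, u, v, c]).det ≠ 0 := by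
  have h3 : LinearIndependent ℂ ![h, u, v] := by
    refine linearIndependent_finCons.mpr ⟨huv, ?_⟩
    rwa [range_pair]
  obtain ⟨c, hc⟩ : ∃ c, c ∉ Submodule.span ℂ (Set.range ![h, u, v]) := by
    by_contra! hc
    have h1 : Submodule.span ℂ (Set.range ![h, u, v]) = ⊤ := by
      rw [eq_top_iff]; exact fun c _ => hc c
    have h2 := finrank_span_eq_card h3
    rw [h1] at h2
    simp at h2
  have h4 : LinearIndependent ℂ ![c, h, u, v] := by
    exact linearIndependent_finCons.mpr ⟨h3, hc⟩
  refine ⟨c, ?_⟩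
  have := det_ne_zero_of_linearIndependent h4
  contrapose! this
  rw [← neg_eq_zero, ← this]
  simp [Matrix.det_succ_row_zero, Fin.sum_univ_succ, Fin.succAbove]
  ring

theorem cross4_eq_zero {u v : Fin 4 → ℂ} (h : ¬ LinearIndependent ℂ ![u, v]) (c : Fin 4 → ℂ) :
    cross4 c u v = 0 := by
  funext i
  by_contra hne
  have hunit := (Matrix.isUnit_iff_isUnit_det _).mpr (Ne.isUnit hne)
  have hli := (Matrix.linearIndependent_rows_iff_isUnit.mpr hunit).comp ![2, 3] (by decide)
  apply h
  convert! hli using 1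
  ext j : 1
  fin_cases j <;> rfl

/-- The orthogonal complement of a subspace for the standard bilinear form. -/
def perp {n : ℕ} (W : Submodule ℂ (Fin n → ℂ)) : Submodule ℂ (Fin n → ℂ) where
  carrier := {y | ∀ w ∈ W, y ⬝ᵥ w = 0}
  zero_mem' := by simp
  add_mem' := fun ha hb w hw => by rw [add_dotProduct, ha w hw, hb w hw, add_zero]
  smul_mem' := fun c a ha w hw => by rw [smul_dotProduct, ha w hw, smul_zero]

theorem mem_perp_span {n : ℕ} {s : Set (Fin n → ℂ)} {y : Fin n → ℂ} :
    y ∈ perp (Submodule.span ℂ s) ↔ ∀ w ∈ s, y ⬝ᵥ w = 0 := by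
  refine ⟨fun h w hw => h w (Submodule.subset_span hw), fun h w hw => ?_⟩
  induction hw using Submodule.span_induction with
  | mem w hw => exact h w hw
  | zero => simp
  | add a b _ _ ha hb => rw [dotProduct_add, ha, hb, add_zero]
  | smul c a _ ha => rw [dotProduct_smul, ha, smul_zero]

theorem finrank_perp {n : ℕ} (W : Submodule ℂ (Fin n → ℂ)) :
    Module.finrank ℂ W + Module.finrank ℂ (perp W) = n := by
  have := Subspace.finrank_add_finrank_dualAnnihilator_eq W
  rw [Module.finrank_fin_fun] at this
  refine Eq.trans ?_ this
  congr 1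
  refine LinearEquiv.finrank_eq ?_
  refine LinearEquiv.ofSubmodules (dotProductEquiv ℂ (Fin n)) _ _ ?_
  ext φ
  simp only [Submodule.mem_map, Submodule.mem_dualAnnihilator]
  constructor
  · rintro ⟨y, hy, rfl⟩ w hw
    exact hy w hw
  · intro h
    refine ⟨(dotProductEquiv ℂ (Fin n)).symm φ, fun w hw => ?_, by simp⟩
    have := h w hw
    rw [← (dotProductEquiv ℂ (Fin n)).apply_symm_apply φ] at this
    exact this

theorem perp_perp {n : ℕ} (W : Submodule ℂ (Fin n → ℂ)) : perp (perp W) = W := by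
  refine (Submodule.eq_of_le_of_finrank_le (fun w hw y hy => ?_) ?_).symm
  · rw [dotProduct_comm]
    exact hy w hw
  · have h1 := finrank_perp W
    have h2 := finrank_perp (perp W)
    omega

/-- Dimension count: `c ↦ cross4 c u v` has kernel inside `span {u, v}`, so its rank is at least
two, and its range lies in the two-dimensional orthogonal complement. -/
theorem exists_eq_cross4 {u v y : Fin 4 → ℂ} (huv : LinearIndependent ℂ ![u, v])
    (hu : y ⬝ᵥ u = 0) (hv : y ⬝ᵥ v = 0) : ∃ c, y = cross4 c u v := by
  let T : (Fin 4 → ℂ) →ₗ[ℂ] (Fin 4 → ℂ) :=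
    { toFun := fun c => cross4 c u v
      map_add' := fun a b => by
        funext i
        simp [cross4, Matrix.det_succ_row_zero, Fin.sum_univ_succ, Fin.succAbove]
        ring
      map_smul' := fun a b => by
        funext i
        simp [cross4, Matrix.det_succ_row_zero, Fin.sum_univ_succ, Fin.succAbove]
        ring }
  have hW : Module.finrank ℂ (Submodule.span ℂ {u, v}) = 2 := by
    exact finrank_span_pair huv
  have hker : LinearMap.ker T ≤ Submodule.span ℂ {u, v} := by
    intro c hc
    by_contra hcon
    obtain ⟨d, hd⟩ := exists_det_ne_zero huv hcon
    apply hd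
    have h1 : cross4 c u v = 0 := hc
    have h2 := cross4_dotProduct c u v d
    rw [h1, zero_dotProduct] at h2
    rw [← neg_eq_zero, h2]
    simp [Matrix.det_succ_row_zero, Fin.sum_univ_succ, Fin.succAbove]
    ring
  have hrange : LinearMap.range T ≤ perp (Submodule.span ℂ {u, v}) := by
    rintro _ ⟨c, rfl⟩
    rw [mem_perp_span]
    rintro w (rfl | rfl)
    · exact cross4_dotProduct_middle _ _ _
    · exact cross4_dotProduct_right _ _ _
  have h1 := Submodule.finrank_mono hker
  have h2 := LinearMap.finrank_range_add_finrank_ker T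
  have h3 := finrank_perp (Submodule.span ℂ {u, v})
  rw [Module.finrank_fin_fun] at h2
  have heq := Submodule.eq_of_le_of_finrank_le hrange (by omega)
  have hy : y ∈ perp (Submodule.span ℂ {u, v}) := by
    rw [mem_perp_span]
    rintro w (rfl | rfl) <;> assumption
  rw [← heq] at hy
  obtain ⟨c, hc⟩ := hy
  exact ⟨c, hc.symm⟩

theorem exists_basis_pair {n : ℕ} {W : Submodule ℂ (Fin n → ℂ)} (hW : Module.finrank ℂ W = 2) :
    ∃ u ∈ W, ∃ v ∈ W, LinearIndependent ℂ ![u, v] ∧ Submodule.span ℂ {u, v} = W := by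
  let b := Module.finBasisOfFinrankEq ℂ W hW
  have hli : LinearIndependent ℂ ![(b 0 : Fin n → ℂ), (b 1 : Fin n → ℂ)] := by
    have := b.linearIndependent.map' W.subtype (Submodule.ker_subtype W)
    convert! this using 1
    ext i : 1
    fin_cases i <;> rfl
  refine ⟨b 0, (b 0).2, b 1, (b 1).2, hli, ?_⟩
  refine Submodule.eq_of_le_of_finrank_le ?_ ?_
  · rw [Submodule.span_le]
    rintro w (rfl | rfl)
    exacts [(b 0).2, (b 1).2]
  · rw [hW]
    exact (finrank_span_pair hli).ge

/-! ### Cones, their ideals and their conormal spaces -/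

section Cone

variable {n : ℕ} {S : Set (Proj n)} {x : Fin n → ℂ} {f : MvPolynomial (Fin n) ℂ}

theorem mem_idealOf : f ∈ idealOf S ↔ ∀ x ∈ coords S, eval x f = 0 := by
  simp [idealOf, mem_vanishingIdeal_iff, aeval_eq_eval]

theorem ne_zero_of_mem_coords (hx : x ∈ coords S) : x ≠ 0 := hx.1

theorem smul_mem_coords (hx : x ∈ coords S) {c : ℂ} (hc : c ≠ 0) : c • x ∈ coords S := by
  obtain ⟨h0, h⟩ := hx
  refine ⟨smul_ne_zero hc h0, ?_⟩
  convert h using 1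
  rw [Projectivization.mk_eq_mk_iff]
  exact ⟨Units.mk0 c hc, rfl⟩

theorem gradient_add (f g : MvPolynomial (Fin n) ℂ) (x : Fin n → ℂ) :
    gradient (f + g) x = gradient f x + gradient g x := by
  funext i; simp [gradient]

theorem gradient_smul (c : ℂ) (f : MvPolynomial (Fin n) ℂ) (x : Fin n → ℂ) :
    gradient (C c * f) x = c • gradient f x := by
  funext i; simp [gradient]

/-- The gradients at `x` are already closed under sums and scalars, so each conormal vector comes
from one polynomial. -/
theorem mem_conormal {w : Fin n → ℂ} : w ∈ conormal S x ↔ ∃ f ∈ idealOf S, w = gradient f x := by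
  refine ⟨fun h => ?_, fun h => Submodule.subset_span h⟩
  induction h using Submodule.span_induction with
  | mem w hw => exact hw
  | zero => exact ⟨0, Ideal.zero_mem _, by funext i; simp [gradient]⟩
  | add a b _ _ ha hb =>
    obtain ⟨f, hf, rfl⟩ := ha
    obtain ⟨g, hg, rfl⟩ := hb
    exact ⟨f + g, Ideal.add_mem _ hf hg, (gradient_add _ _ _).symm⟩
  | smul c a _ ha =>
    obtain ⟨f, hf, rfl⟩ := ha
    exact ⟨C c * f, Ideal.mul_mem_left _ _ hf, (gradient_smul _ _ _).symm⟩

/-- The composition of a polynomial with a linear map. -/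
def pullback {m n : ℕ} (M : Matrix (Fin m) (Fin n) ℂ) :
    MvPolynomial (Fin m) ℂ →ₐ[ℂ] MvPolynomial (Fin n) ℂ :=
  aeval fun i => ∑ k, C (M i k) * X k

theorem eval_pullback {m n : ℕ} (M : Matrix (Fin m) (Fin n) ℂ) (f : MvPolynomial (Fin m) ℂ)
    (x : Fin n → ℂ) : eval x (pullback M f) = eval (M *ᵥ x) f := by
  have : (eval x).comp (pullback M : _ →+* _) = eval (M *ᵥ x) := by
    ext i
    · simp [pullback]
    · simp [pullback, Matrix.mulVec, dotProduct]
  exact congrArg (fun φ => φ f) this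

theorem gradient_pullback {m n : ℕ} (M : Matrix (Fin m) (Fin n) ℂ) (f : MvPolynomial (Fin m) ℂ)
    (x : Fin n → ℂ) : gradient (pullback M f) x = Mᵀ *ᵥ gradient f (M *ᵥ x) := by
  funext j
  have h := pderiv_aeval_linear M f j
  change pderiv j (pullback M f) = ∑ i, C (M i j) * pullback M (pderiv i f) at h
  simp [gradient, h, eval_pullback, Matrix.mulVec, dotProduct]

theorem pullback_smul_one_mem_idealOf (hf : f ∈ idealOf S) {c : ℂ} (hc : c ≠ 0) :
    pullback (c • (1 : Matrix (Fin n) (Fin n) ℂ)) f ∈ idealOf S := by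
  rw [mem_idealOf] at hf ⊢
  intro x hx
  rw [eval_pullback, Matrix.smul_mulVec, Matrix.one_mulVec]
  exact hf _ (smul_mem_coords hx hc)

theorem conormal_smul_le {c : ℂ} (hc : c ≠ 0) : conormal S (c • x) ≤ conormal S x := by
  intro w hw
  obtain ⟨f, hf, rfl⟩ := mem_conormal.mp hw
  have h : gradient (pullback (c • (1 : Matrix (Fin n) (Fin n) ℂ)) f) x ∈ conormal S x :=
    mem_conormal.mpr ⟨_, pullback_smul_one_mem_idealOf hf hc, rfl⟩
  rw [gradient_pullback, Matrix.transpose_smul, Matrix.smul_mulVec, Matrix.smul_mulVec,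
    Matrix.transpose_one, Matrix.one_mulVec, Matrix.one_mulVec] at h
  simpa [smul_smul, hc] using (conormal S x).smul_mem c⁻¹ h

theorem conormal_smul {c : ℂ} (hc : c ≠ 0) : conormal S (c • x) = conormal S x := by
  refine le_antisymm (conormal_smul_le hc) ?_
  have := conormal_smul_le (S := S) (x := c • x) (inv_ne_zero hc)
  rwa [smul_smul, inv_mul_cancel₀ hc, one_smul] at this

theorem homogeneousComponent_mem_idealOf (hf : f ∈ idealOf S) (d : ℕ) :
    homogeneousComponent d f ∈ idealOf S := by
  rw [mem_idealOf] at hf ⊢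
  exact fun x hx => eval_homogeneousComponent_eq_zero (fun c hc => hf _ (smul_mem_coords hx hc)) d

/-- Euler's formula, applied to each homogeneous component; these again vanish on the cone. -/
theorem gradient_dotProduct_self (hf : f ∈ idealOf S) (hx : x ∈ coords S) :
    gradient f x ⬝ᵥ x = 0 := by
  have key : ∀ d, gradient (homogeneousComponent d f) x ⬝ᵥ x = 0 := by
    intro d
    have h1 := congrArg (eval x) (homogeneousComponent_isHomogeneous d f).sum_X_mul_pderiv
    have h2 := mem_idealOf.mp (homogeneousComponent_mem_idealOf hf d) x hx
    simp only [map_sum, map_mul, eval_X, map_nsmul, h2, smul_zero] at h1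
    simpa [dotProduct, gradient, mul_comm] using h1
  have hsum : gradient f x = ∑ d ∈ Finset.range (f.totalDegree + 1),
      gradient (homogeneousComponent d f) x := by
    funext i
    conv_lhs => rw [← sum_homogeneousComponent f]
    simp only [gradient, map_sum, Finset.sum_apply]
  rw [hsum, sum_dotProduct]
  exact Finset.sum_eq_zero fun d _ => key d

theorem mem_conormal_dotProduct_self {w : Fin n → ℂ} (hw : w ∈ conormal S x) (hx : x ∈ coords S) :
    w ⬝ᵥ x = 0 := by
  obtain ⟨f, hf, rfl⟩ := mem_conormal.mp hw
  exact gradient_dotProduct_self hf hx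

theorem mem_coords_zariskiClosure :
    x ∈ coords (zariskiClosure S) ↔ x ≠ 0 ∧ ∀ f ∈ idealOf S, eval x f = 0 := by
  refine ⟨fun ⟨h0, h⟩ => ⟨h0, fun f hf => h f hf x h0 rfl⟩, fun ⟨h0, h⟩ => ⟨h0, ?_⟩⟩
  intro f hf v hv hvx
  obtain ⟨c, rfl⟩ := (Projectivization.mk_eq_mk_iff ℂ v x hv h0).mp hvx
  have := h _ (pullback_smul_one_mem_idealOf hf c.ne_zero)
  rwa [eval_pullback, Matrix.smul_mulVec, Matrix.one_mulVec] at this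

theorem idealOf_zariskiClosure : idealOf (zariskiClosure S) = idealOf S := by
  ext f
  refine ⟨fun h => ?_, fun h => ?_⟩
  · rw [mem_idealOf] at h ⊢
    intro x hx
    refine h x (mem_coords_zariskiClosure.mpr ⟨hx.1, fun g hg => mem_idealOf.mp hg x hx⟩)
  · rw [mem_idealOf]
    intro x hx
    exact (mem_coords_zariskiClosure.mp hx).2 f h

end Cone

/-! ### Dimension counts on a space curve -/

section Curve

variable {X : Set (Proj 4)}

theorem IsSmoothSpaceCurve.mem_coords (hX : IsSmoothSpaceCurve X) {x : Fin 4 → ℂ} :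
    x ∈ coords X ↔ x ≠ 0 ∧ ∀ f ∈ idealOf X, eval x f = 0 := by
  rw [← mem_coords_zariskiClosure, hX.closed]

theorem IsSmoothSpaceCurve.coords_nonempty (hX : IsSmoothSpaceCurve X) : (coords X).Nonempty := by
  by_contra! h
  refine hX.irreducible.ne_top ?_
  rw [Ideal.eq_top_iff_one, mem_idealOf]
  simp [h]

/-- `B[s, t]` has dimension at most three, so four elements `s u j + t w j` are algebraically
dependent. -/
theorem exists_ne_zero_aeval_eq_zero {B : Type} [CommRing B] [Algebra ℂ B]
    [Algebra.FiniteType ℂ B] (hB : ringKrullDim B + 1 ≤ 2) (u w : Fin 4 → B) :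
    ∃ g : MvPolynomial (Fin 4) ℂ, g ≠ 0 ∧
      aeval (fun j => (MvPolynomial.X 0 * C (u j) + MvPolynomial.X 1 * C (w j) :
        MvPolynomial (Fin 2) B)) g = 0 := by
  by_contra! hφ
  have hinj := (injective_iff_map_eq_zero (aeval (R := ℂ) (fun j =>
    (MvPolynomial.X 0 * C (u j) + MvPolynomial.X 1 * C (w j) : MvPolynomial (Fin 2) B)))).mpr
    fun g hg => by_contra fun h => hφ g h hg
  have hft : Algebra.FiniteType ℂ (MvPolynomial (Fin 2) B) :=
    Algebra.FiniteType.trans (S := B) inferInstance inferInstance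
  have : IsNoetherianRing B := Algebra.FiniteType.isNoetherianRing ℂ B
  have h4 := natCast_le_ringKrullDim_of_injective (n := 4) _ hinj
  rw [MvPolynomial.ringKrullDim_of_isNoetherianRing] at h4
  have h5 : ((4 : ℕ) : WithBot ℕ∞) ≤ (3 : ℕ) := by
    calc ((4 : ℕ) : WithBot ℕ∞) ≤ ringKrullDim B + 1 + 1 := by
          rw [add_assoc, one_add_one_eq_two]
          simpa using h4
      _ ≤ 2 + 1 := by gcongr
      _ = (3 : ℕ) := by norm_num
  exact absurd (Nat.cast_le.mp h5) (by norm_num)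

/-- `B` is the coordinate ring of the slice `x i = 1` of the cone, the quotient of a two-dimensional
domain by a nonzero element. -/
theorem IsSmoothSpaceCurve.exists_hyperplane_section (hX : IsSmoothSpaceCurve X) (i : Fin 4) :
    ∃ (B : Type) (_ : CommRing B) (_ : Algebra ℂ B) (π : MvPolynomial (Fin 4) ℂ →ₐ[ℂ] B),
      Algebra.FiniteType ℂ B ∧ ringKrullDim B + 1 ≤ 2 ∧ ∀ x ∈ coords X, x i = 1 →
        ∃ ev : B →+* ℂ, ev.comp π.toRingHom = eval x := by
  let A := MvPolynomial (Fin 4) ℂ ⧸ idealOf X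
  have := hX.irreducible
  let r : A := Ideal.Quotient.mk _ (MvPolynomial.X i - 1)
  let π : MvPolynomial (Fin 4) ℂ →ₐ[ℂ] A ⧸ Ideal.span {r} :=
    (Ideal.Quotient.mkₐ ℂ (Ideal.span {r})).comp (Ideal.Quotient.mkₐ ℂ (idealOf X))
  -- A coordinate cannot equal one at both `x` and `2 x`.
  have hr : r ≠ 0 := by
    intro h
    rw [Ideal.Quotient.eq_zero_iff_mem, mem_idealOf] at h
    obtain ⟨x, hx⟩ := hX.coords_nonempty
    have h1 := h x hx
    have h2 := h _ (smul_mem_coords hx (two_ne_zero (α := ℂ)))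
    simp [sub_eq_zero] at h1 h2
    rw [h1] at h2
    norm_num at h2
  have : Algebra.FiniteType ℂ A := inferInstance
  refine ⟨A ⧸ Ideal.span {r}, inferInstance, inferInstance, π, inferInstance, ?_, ?_⟩
  · rw [← hX.dim_one]
    exact ringKrullDim_quotient_succ_le_of_nonZeroDivisor (mem_nonZeroDivisors_of_ne_zero hr)
  · intro x hx hxi
    let ev₀ : A →+* ℂ := Ideal.Quotient.lift _ (eval x) fun f hf => mem_idealOf.mp hf x hx
    have hev₀ : ev₀ r = 0 := (Ideal.Quotient.lift_mk _ _ _).trans (by simp [hxi])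
    exact ⟨Ideal.Quotient.lift _ ev₀
      ((Ideal.span_singleton_le_iff_mem (RingHom.ker ev₀)).mpr hev₀), rfl⟩

/-- The image of a surface swept out by a one-parameter family of lines is not dense. -/
theorem IsSmoothSpaceCurve.exists_vanishing_on_span (hX : IsSmoothSpaceCurve X) (i : Fin 4)
    (u w : Fin 4 → MvPolynomial (Fin 4) ℂ) :
    ∃ g : MvPolynomial (Fin 4) ℂ, g ≠ 0 ∧ ∀ x ∈ coords X, x i = 1 → ∀ s t : ℂ,
      eval (fun j => s * eval x (u j) + t * eval x (w j)) g = 0 := by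
  obtain ⟨B, _, _, π, _, hdim, hev⟩ := hX.exists_hyperplane_section i
  obtain ⟨g, hg0, hg⟩ := exists_ne_zero_aeval_eq_zero hdim (fun j => π (u j)) fun j => π (w j)
  refine ⟨g, hg0, fun x hx hxi s t => ?_⟩
  obtain ⟨ev, hev⟩ := hev x hx hxi
  have hev' : ∀ p, ev (π p) = eval x p := fun p => congrArg (fun φ => φ p) hev
  have hC : ∀ c, ev (algebraMap ℂ B c) = c := fun c => by
    rw [← π.commutes, hev']
    simp
  have hcomp := congrArg (eval₂Hom ev ![s, t]) hg
  rw [aeval_def, hom_eval₂, map_zero] at hcomp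
  rw [← hcomp, eval, ← coe_eval₂Hom]
  congr 2
  · ext c
    rw [RingHom.comp_apply, IsScalarTower.algebraMap_apply ℂ B (MvPolynomial (Fin 2) B),
      MvPolynomial.algebraMap_eq]
    simp [hC]
  · funext j
    simp [hev']

end Curve

/-! ### The dual surface and the tangent developable are proper subvarieties -/

section Curve

variable {X : Set (Proj 4)}

/-- A two-dimensional family of planes parametrized by the cone over a curve, constant along the
rulings of the cone, does not fill four-space. -/
theorem IsSmoothSpaceCurve.exists_vanishing_on_family (hX : IsSmoothSpaceCurve X)
    (𝓕 : Set (Fin 4 → MvPolynomial (Fin 4) ℂ)) (V : (Fin 4 → ℂ) → Submodule ℂ (Fin 4 → ℂ))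
    (h𝓕 : ∀ x ∈ coords X, ∀ y, y ∈ V x ↔ ∃ u ∈ 𝓕, y = fun i => eval x (u i))
    (hV : ∀ x ∈ coords X, Module.finrank ℂ (V x) = 2)
    (hsmul : ∀ x ∈ coords X, ∀ c : ℂ, c ≠ 0 → V (c • x) = V x) :
    ∃ g : MvPolynomial (Fin 4) ℂ, g ≠ 0 ∧ ∀ x ∈ coords X, ∀ y ∈ V x, eval y g = 0 := by
  obtain ⟨x₀, hx₀, i, hi⟩ : ∃ x ∈ coords X, ∃ i, x i = 1 := by
    obtain ⟨x, hx⟩ := hX.coords_nonempty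
    obtain ⟨i, hi⟩ := Function.ne_iff.mp (ne_zero_of_mem_coords hx)
    exact ⟨_, smul_mem_coords hx (inv_ne_zero hi), i, by simpa using inv_mul_cancel₀ hi⟩
  obtain ⟨y, hy, z, hz, hyz, -⟩ := exists_basis_pair (hV x₀ hx₀)
  obtain ⟨u, hu, rfl⟩ := (h𝓕 x₀ hx₀ y).mp hy
  obtain ⟨w, hw, rfl⟩ := (h𝓕 x₀ hx₀ z).mp hz
  obtain ⟨g, hg0, hg⟩ := hX.exists_vanishing_on_span i u w
  refine ⟨g, hg0, ?_⟩
  -- Where this minor is nonzero, `u` and `w` still span `V x`, so that the polynomial `g` obtained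
  -- from them vanishes there.
  obtain ⟨a, b, hab⟩ : ∃ a b : Fin 4, eval x₀ (u a * w b - u b * w a) ≠ 0 := by
    by_contra! hcon
    simp only [map_sub, map_mul] at hcon
    rw [LinearIndependent.pair_iff] at hyz
    have h0 : (fun i => eval x₀ (w i)) = 0 := by
      funext a
      by_contra ha
      have := hyz (eval x₀ (w a)) (- eval x₀ (u a)) (by
        funext b
        have := hcon a b
        simp only [Pi.add_apply, Pi.smul_apply, smul_eq_mul, Pi.zero_apply]
        linear_combination -this)
      exact ha this.1
    have := hyz 0 1 (by simp [h0])
    exact one_ne_zero this.2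
  -- The vanishing of `g` is known only on the slice `x i = 1`; homogenizing the minor lets it be
  -- tested at any point of the cone with `x i ≠ 0`.
  obtain ⟨q, N, hq⟩ := exists_dehomogenization (u a * w b - u b * w a) i
  have hqI : MvPolynomial.X i * q ∉ idealOf X := by
    intro h
    have := mem_idealOf.mp h x₀ hx₀
    rw [map_mul, eval_X, hq x₀ (by simp [hi]), hi] at this
    simp at this hab
    exact hab this
  have hkey : ∀ x ∈ coords X, eval x (MvPolynomial.X i * q) ≠ 0 → ∀ y ∈ V x, eval y g = 0 := by
    intro x hx hxq y hy
    rw [map_mul, eval_X] at hxq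
    have hxi := left_ne_zero_of_mul hxq
    have hm := right_ne_zero_of_mul hxq
    rw [hq x hxi] at hm
    have hx' := smul_mem_coords hx (inv_ne_zero hxi)
    rw [← hsmul x hx _ (inv_ne_zero hxi)] at hy
    set x' := (x i)⁻¹ • x
    have hm' := right_ne_zero_of_mul hm
    have hli : LinearIndependent ℂ ![fun i => eval x' (u i), fun i => eval x' (w i)] := by
      rw [LinearIndependent.pair_iff]
      intro s t hst
      have ha := congrFun hst a
      have hb := congrFun hst b
      simp only [Pi.add_apply, Pi.smul_apply, smul_eq_mul, Pi.zero_apply] at ha hb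
      simp only [map_sub, map_mul] at hm'
      constructor
      · refine (mul_eq_zero.mp ?_).resolve_right hm'
        linear_combination eval x' (w b) * ha - eval x' (w a) * hb
      · refine (mul_eq_zero.mp ?_).resolve_right hm'
        linear_combination eval x' (u a) * hb - eval x' (u b) * ha
    have hspan : Submodule.span ℂ {fun i => eval x' (u i), fun i => eval x' (w i)} = V x' := by
      refine Submodule.eq_of_le_of_finrank_le ?_ ?_
      · rw [Submodule.span_le]
        rintro _ (rfl | rfl)
        exacts [(h𝓕 x' hx' _).mpr ⟨u, hu, rfl⟩, (h𝓕 x' hx' _).mpr ⟨w, hw, rfl⟩]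
      · rw [hV x' hx', finrank_span_pair hli]
    rw [← hspan] at hy
    obtain ⟨s, t, rfl⟩ := Submodule.mem_span_pair.mp hy
    exact hg x' hx' (by simp [x', hxi]) s t
  intro x hx y hy
  obtain ⟨p, hp, rfl⟩ := (h𝓕 x hx y).mp hy
  have hcomp : ∀ x, eval x (bind₁ p g) = eval (fun i => eval x (p i)) g := fun x => by
    rw [← aeval_eq_eval, aeval_bind₁]
    rfl
  -- The remaining points are reached by irreducibility: the product vanishes on `X` and its first
  -- factor does not.
  have hmem : MvPolynomial.X i * q * bind₁ p g ∈ idealOf X := by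
    rw [mem_idealOf]
    intro x hx
    rw [map_mul]
    by_cases h : eval x (MvPolynomial.X i * q) = 0
    · rw [h, zero_mul]
    · rw [hcomp, hkey x hx h _ ((h𝓕 x hx _).mpr ⟨p, hp, rfl⟩), mul_zero]
  have := (hX.irreducible.mem_or_mem hmem).resolve_left hqI
  rw [← hcomp]
  exact mem_idealOf.mp this x hx

/-- The ideal of the dual surface: the polynomials vanishing on all conormal spaces. -/
def dualIdeal (X : Set (Proj 4)) : Ideal (MvPolynomial (Fin 4) ℂ) :=
  vanishingIdeal ℂ {h | ∃ x ∈ coords X, h ∈ conormal X x}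

theorem mem_dualIdeal {g : MvPolynomial (Fin 4) ℂ} :
    g ∈ dualIdeal X ↔ ∀ x ∈ coords X, ∀ h ∈ conormal X x, eval h g = 0 := by
  simp only [dualIdeal, mem_vanishingIdeal_iff, aeval_eq_eval]
  exact ⟨fun H x hx h hh => H h ⟨x, hx, hh⟩, fun H h ⟨x, hx, hh⟩ => H x hx h hh⟩

theorem IsSmoothSpaceCurve.dualIdeal_ne_bot (hX : IsSmoothSpaceCurve X) : dualIdeal X ≠ ⊥ := by
  obtain ⟨g, hg0, hg⟩ := hX.exists_vanishing_on_family
    {u | ∃ f ∈ idealOf X, u = fun i => pderiv i f} (conormal X) (fun x hx y => by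
      rw [mem_conormal]
      constructor
      · rintro ⟨f, hf, rfl⟩
        exact ⟨_, ⟨f, hf, rfl⟩, rfl⟩
      · rintro ⟨_, ⟨f, hf, rfl⟩, rfl⟩
        exact ⟨f, hf, rfl⟩) hX.smooth fun x hx c hc => conormal_smul hc
  exact fun h => hg0 (by rw [← Ideal.mem_bot, ← h, mem_dualIdeal]; exact hg)

theorem IsSmoothSpaceCurve.cross4_mem_perp (hX : IsSmoothSpaceCurve X) {x : Fin 4 → ℂ}
    (hx : x ∈ coords X) {u v : Fin 4 → ℂ} (hu : u ∈ conormal X x) (hv : v ∈ conormal X x)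
    (c : Fin 4 → ℂ) : cross4 c u v ∈ perp (conormal X x) := by
  by_cases hli : LinearIndependent ℂ ![u, v]
  · have hs : Submodule.span ℂ {u, v} = conormal X x := by
      refine Submodule.eq_of_le_of_finrank_le ?_ ?_
      · rw [Submodule.span_le]
        rintro _ (rfl | rfl) <;> assumption
      · rw [hX.smooth x hx, finrank_span_pair hli]
    rw [← hs, mem_perp_span]
    rintro w (rfl | rfl)
    · exact cross4_dotProduct_middle _ _ _
    · exact cross4_dotProduct_right _ _ _
  · rw [cross4_eq_zero hli]
    exact Submodule.zero_mem _

/-- The developable of tangent lines is contained in a surface. -/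
theorem IsSmoothSpaceCurve.exists_vanishing_on_tangents (hX : IsSmoothSpaceCurve X) :
    ∃ g : MvPolynomial (Fin 4) ℂ, g ≠ 0 ∧
      ∀ x ∈ coords X, ∀ y ∈ perp (conormal X x), eval y g = 0 := by
  have hc : ∀ (x c : Fin 4 → ℂ) (f f' : MvPolynomial (Fin 4) ℂ),
      (fun i => eval x (cross4 (fun i => C (c i)) (fun i => pderiv i f) (fun i => pderiv i f') i)) =
        cross4 c (gradient f x) (gradient f' x) := by
    intro x c f f'
    rw [map_cross4]
    congr 1
    funext i
    simp
  -- The tangent space is orthogonal to two independent gradients, so its vectors are the products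
  -- `cross4 c ∇f ∇f'`, polynomial in the point.
  refine hX.exists_vanishing_on_family
    {u | ∃ c : Fin 4 → ℂ, ∃ f ∈ idealOf X, ∃ f' ∈ idealOf X,
      u = cross4 (fun i => C (c i)) (fun i => pderiv i f) (fun i => pderiv i f')}
    (fun x => perp (conormal X x)) (fun x hx y => ?_) (fun x hx => ?_)
    fun x hx c hc => by rw [conormal_smul hc]
  · constructor
    · intro hy
      obtain ⟨u, hu, v, hv, huv, hspan⟩ := exists_basis_pair (hX.smooth x hx)
      obtain ⟨f, hf, rfl⟩ := mem_conormal.mp hu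
      obtain ⟨f', hf', rfl⟩ := mem_conormal.mp hv
      obtain ⟨c, rfl⟩ := exists_eq_cross4 huv (hy _ hu) (hy _ hv)
      exact ⟨_, ⟨c, f, hf, f', hf', rfl⟩, (hc x c f f').symm⟩
    · rintro ⟨_, ⟨c, f, hf, f', hf', rfl⟩, rfl⟩
      rw [hc]
      exact hX.cross4_mem_perp hx (mem_conormal.mpr ⟨f, hf, rfl⟩) (mem_conormal.mpr ⟨f', hf', rfl⟩) c
  · have := finrank_perp (conormal X x)
    rw [hX.smooth x hx] at this
    omega

end Curve

/-! ### The ideal of the dual surface is prime and principal -/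

section Curve

variable {X : Set (Proj 4)}

/-- If `g₁` and `g₂` fail to vanish on the gradients of `f₁` and `f₂` respectively, interpolate by
`f₁ + t (f₂ - f₁)`. Both restrictions are nonzero in `A[t]`, a domain, as seen at `t = 0` and `t =
1`, whereas their product vanishes at every complex `t`. -/
theorem IsSmoothSpaceCurve.dualIdeal_isPrime (hX : IsSmoothSpaceCurve X) :
    (dualIdeal X).IsPrime := by
  have hcomp : ∀ (f g : MvPolynomial (Fin 4) ℂ) (x : Fin 4 → ℂ),
      eval x (bind₁ (fun i => pderiv i f) g) = eval (gradient f x) g := fun f g x => by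
    rw [← aeval_eq_eval, aeval_bind₁]
    rfl
  have hmem : ∀ g, g ∈ dualIdeal X ↔ ∀ f ∈ idealOf X, bind₁ (fun i => pderiv i f) g ∈ idealOf X := by
    intro g
    simp only [mem_dualIdeal, mem_conormal, mem_idealOf, hcomp]
    constructor
    · intro h f hf x hx
      exact h x hx _ ⟨f, hf, rfl⟩
    · rintro h x hx _ ⟨f, hf, rfl⟩
      exact h f hf x hx
  refine ⟨fun h => ?_, fun {g₁ g₂} h => ?_⟩
  · rw [Ideal.eq_top_iff_one, hmem] at h
    have := h 0 (Ideal.zero_mem _)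
    rw [map_one] at this
    exact hX.irreducible.ne_top ((Ideal.eq_top_iff_one _).mpr this)
  by_contra! hcon
  rw [hmem g₁, hmem g₂] at hcon
  push Not at hcon
  obtain ⟨⟨f₁, hf₁, h₁⟩, f₂, hf₂, h₂⟩ := hcon
  have := hX.irreducible
  let A := MvPolynomial (Fin 4) ℂ ⧸ idealOf X
  let π : MvPolynomial (Fin 4) ℂ →ₐ[ℂ] A := Ideal.Quotient.mkₐ ℂ (idealOf X)
  let P : MvPolynomial (Fin 4) ℂ →ₐ[ℂ] Polynomial A := aeval fun i =>
    Polynomial.C (π (pderiv i f₁)) + Polynomial.X * Polynomial.C (π (pderiv i (f₂ - f₁)))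
  have hP : ∀ (t : ℂ) g, (P g).eval (algebraMap ℂ A t) =
      π (bind₁ (fun i => pderiv i (f₁ + C t * (f₂ - f₁))) g) := by
    intro t g
    have : ((Polynomial.aeval (algebraMap ℂ A t)).restrictScalars ℂ).comp P =
      π.comp (bind₁ (fun i => pderiv i (f₁ + C t * (f₂ - f₁)))) := by
      ext i
      have : π (C t) = algebraMap ℂ A t := π.commutes t
      simp [P, this]
    exact congrArg (fun φ => φ g) this
  have hπ : ∀ p, π p = 0 ↔ p ∈ idealOf X := fun p => Ideal.Quotient.eq_zero_iff_mem
  have hP₁ : P g₁ ≠ 0 := by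
    intro h0
    have := hP 0 g₁
    rw [h0, Polynomial.eval_zero] at this
    apply h₁
    rw [← hπ, this]
    simp
  have hP₂ : P g₂ ≠ 0 := by
    intro h0
    have := hP 1 g₂
    rw [h0, Polynomial.eval_zero] at this
    apply h₂
    rw [← hπ, this]
    simp
  refine mul_ne_zero hP₁ hP₂ (Polynomial.eq_zero_of_infinite_isRoot _ ?_)
  refine (Set.infinite_range_of_injective (algebraMap ℂ A).injective).mono ?_
  rintro _ ⟨t, rfl⟩
  rw [Set.mem_ofPred_eq, Polynomial.IsRoot.def, ← map_mul, hP, hπ]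
  exact (hmem _).mp h _ (Ideal.add_mem _ hf₁ (Ideal.mul_mem_left _ _ (Ideal.sub_mem _ hf₂ hf₁)))

/-- A basis of `W` parametrizes it and identifies its coordinate ring with a polynomial ring in two
variables. -/
theorem ringKrullDim_quotient_vanishingIdeal {W : Submodule ℂ (Fin 4 → ℂ)}
    (hW : Module.finrank ℂ W = 2) :
    (vanishingIdeal ℂ (W : Set (Fin 4 → ℂ))).IsPrime ∧
      ringKrullDim (MvPolynomial (Fin 4) ℂ ⧸ vanishingIdeal ℂ (W : Set (Fin 4 → ℂ))) = 2 := by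
  obtain ⟨u, -, v, -, huv, hspan⟩ := exists_basis_pair hW
  let ρ : MvPolynomial (Fin 4) ℂ →ₐ[ℂ] MvPolynomial (Fin 2) ℂ :=
    aeval fun j => X 0 * C (u j) + X 1 * C (v j)
  have hρ : ∀ (z : Fin 2 → ℂ) g, eval z (ρ g) = eval (z 0 • u + z 1 • v) g := by
    intro z g
    have : (eval z).comp ρ.toRingHom = eval (z 0 • u + z 1 • v) := by
      ext i <;> simp [ρ]
    exact congrArg (fun φ => φ g) this
  have hker : RingHom.ker ρ = vanishingIdeal ℂ (W : Set (Fin 4 → ℂ)) := by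
    ext g
    rw [RingHom.mem_ker, mem_vanishingIdeal_iff]
    simp only [aeval_eq_eval]
    constructor
    · intro hg y hy
      rw [SetLike.mem_coe, ← hspan] at hy
      obtain ⟨s, t, rfl⟩ := Submodule.mem_span_pair.mp hy
      have := hρ ![s, t] g
      rw [hg, map_zero] at this
      simpa using this.symm
    · intro hg
      refine MvPolynomial.funext fun z => ?_
      rw [hρ, map_zero]
      exact hg _ (hspan ▸ Submodule.mem_span_pair.mpr ⟨z 0, z 1, rfl⟩)
  have hsurj : Function.Surjective ρ := by
    have hlin : ∀ i : Fin 2, ∃ p, ρ p = X i := by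
      have hT : Function.Surjective (Matrix.of ![u, v]).mulVec := by
        have hr : (Matrix.of ![u, v]).rank = 2 := by
          simpa using LinearIndependent.rank_matrix (M := Matrix.of ![u, v]) huv
        have : LinearMap.range (Matrix.of ![u, v]).mulVecLin = ⊤ :=
          Submodule.eq_top_of_finrank_eq (by rw [← Matrix.rank, hr, Module.finrank_fin_fun])
        exact LinearMap.range_eq_top.mp this
      intro i
      obtain ⟨a, ha⟩ := hT (Pi.single i 1)
      have h0 := congrFun ha 0
      have h1 := congrFun ha 1
      refine ⟨∑ j, C (a j) * X j, MvPolynomial.funext fun z => ?_⟩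
      have : eval (z 0 • u + z 1 • v) (∑ j, C (a j) * X j) = z 0 * (u ⬝ᵥ a) + z 1 * (v ⬝ᵥ a) := by
        simp only [map_sum, map_mul, eval_C, eval_X, Pi.add_apply, Pi.smul_apply, smul_eq_mul,
          dotProduct, Finset.mul_sum, ← Finset.sum_add_distrib]
        exact Finset.sum_congr rfl fun _ _ => by ring
      rw [hρ, this, show u ⬝ᵥ a = _ from h0, show v ⬝ᵥ a = _ from h1]
      fin_cases i <;> simp
    rw [← AlgHom.range_eq_top, eq_top_iff, ← MvPolynomial.adjoin_range_X, Algebra.adjoin_le_iff]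
    rintro _ ⟨i, rfl⟩
    exact hlin i
  rw [← hker]
  refine ⟨RingHom.ker_isPrime _, ?_⟩
  rw [ringKrullDim_eq_of_ringEquiv (Ideal.quotientKerAlgEquivOfSurjective hsurj).toRingEquiv,
    MvPolynomial.ringKrullDim_of_isNoetherianRing, ringKrullDim_eq_zero_of_field]
  simp

/-- A nonzero prime contains a prime element `Φ`. If `(Φ)` were not everything, then `0 < (Φ) <
dualIdeal X < 𝔮`, with `𝔮` the ideal of one conormal space and of coheight two, would be too long a
chain for dimension four. -/
theorem IsSmoothSpaceCurve.exists_dualIdeal_eq_span (hX : IsSmoothSpaceCurve X)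
    (hnp : IsNonPlanar X) : ∃ Φ : MvPolynomial (Fin 4) ℂ, Prime Φ ∧ dualIdeal X = Ideal.span {Φ} := by
  have hp := hX.dualIdeal_isPrime
  obtain ⟨Φ, hΦ, hprime⟩ := hp.exists_mem_prime_of_ne_bot hX.dualIdeal_ne_bot
  refine ⟨Φ, hprime, ?_⟩
  by_contra hne
  obtain ⟨x, hx⟩ := hX.coords_nonempty
  obtain ⟨hq, hdim⟩ := ringKrullDim_quotient_vanishingIdeal (hX.smooth x hx)
  set 𝔮 := vanishingIdeal ℂ (conormal X x : Set (Fin 4 → ℂ))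
  have hpq : dualIdeal X < 𝔮 := by
    refine lt_of_le_of_ne (fun g hg => ?_) fun h => ?_
    · rw [mem_vanishingIdeal_iff]
      intro y hy
      exact mem_dualIdeal.mp hg x hx y hy
    -- Equality would make all conormal spaces coincide; any nonzero vector in the common one would
    -- then be a plane containing `X`.
    · have hle : ∀ x' ∈ coords X, conormal X x' = conormal X x := by
        intro x' hx'
        refine Submodule.eq_of_le_of_finrank_le (fun w hh => ?_) ?_
        · rw [← perp_perp (conormal X x)]
          intro y hy
          have hl : ∑ j, C (y j) * MvPolynomial.X j ∈ 𝔮 := by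
            rw [mem_vanishingIdeal_iff]
            intro w hw
            simpa [aeval_eq_eval, dotProduct] using hy w hw
          rw [← h, mem_dualIdeal] at hl
          rw [dotProduct_comm]
          simpa [dotProduct] using hl x' hx' _ hh
        · rw [hX.smooth x hx, hX.smooth x' hx']
      obtain ⟨a, ha, b, -, hab, -⟩ := exists_basis_pair (hX.smooth x hx)
      obtain ⟨v, hv, hav⟩ := hnp a (by simpa using hab.ne_zero 0)
      exact hav (mem_conormal_dotProduct_self (hle v hv ▸ ha) hv)
  have hΦp : Ideal.span {Φ} < dualIdeal X :=
    lt_of_le_of_ne ((Ideal.span_singleton_le_iff_mem _).mpr hΦ) (Ne.symm hne)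
  have hΦprime : (Ideal.span {Φ}).IsPrime := (Ideal.span_singleton_prime hprime.ne_zero).mpr hprime
  have hbot : (⊥ : Ideal (MvPolynomial (Fin 4) ℂ)) < Ideal.span {Φ} := by
    rw [bot_lt_iff_ne_bot, Ne, Ideal.span_singleton_eq_bot]
    exact hprime.ne_zero
  let q : PrimeSpectrum (MvPolynomial (Fin 4) ℂ) := ⟨𝔮, hq⟩
  let p : PrimeSpectrum (MvPolynomial (Fin 4) ℂ) := ⟨_, hp⟩
  let p' : PrimeSpectrum (MvPolynomial (Fin 4) ℂ) := ⟨_, hΦprime⟩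
  let p₀ : PrimeSpectrum (MvPolynomial (Fin 4) ℂ) := ⟨⊥, Ideal.isPrime_bot⟩
  have h1 : (2 : ℕ∞) ≤ Order.coheight q := by
    have h : ((2 : ℕ∞) : WithBot ℕ∞) = Order.coheight q := by
      rw [Order.coheight_eq_krullDim_Ici]
      refine hdim.symm.trans ((ringKrullDim_quotient _).trans ?_)
      rfl
    exact_mod_cast h.le
  have h2 := Order.coheight_add_one_le (show p < q from hpq)
  have h3 := Order.coheight_add_one_le (show p' < p from hΦp)
  have h4 := Order.coheight_add_one_le (show p₀ < p' from hbot)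
  have h5 : (Order.coheight p₀ : WithBot ℕ∞) ≤ (4 : ℕ) := by
    have := Order.coheight_le_krullDim p₀
    refine this.trans_eq ?_
    change ringKrullDim (MvPolynomial (Fin 4) ℂ) = _
    rw [MvPolynomial.ringKrullDim_of_isNoetherianRing, ringKrullDim_eq_zero_of_field]
    simp
  have h6 : ((5 : ℕ) : ℕ∞) ≤ (4 : ℕ) := by
    calc ((5 : ℕ) : ℕ∞) = 2 + 1 + 1 + 1 := by norm_num
      _ ≤ Order.coheight q + 1 + 1 + 1 := by gcongr
      _ ≤ Order.coheight p₀ := by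
        refine le_trans ?_ h4
        gcongr
        refine le_trans ?_ h3
        gcongr
      _ ≤ (4 : ℕ) := WithBot.coe_le_coe.mp h5
  exact absurd (Nat.cast_le.mp h6) (by norm_num)

end Curve

theorem map_homogeneousComponent {σ R S : Type*} [CommSemiring R] [CommSemiring S] (φ : R →+* S)
    (n : ℕ) (p : MvPolynomial σ R) :
    map φ (homogeneousComponent n p) = homogeneousComponent n (map φ p) := by
  ext d
  simp only [coeff_map, coeff_homogeneousComponent]
  split_ifs <;> simp

theorem degree_eq_of_isHomogeneous {σ R : Type*} [CommSemiring R] {p : MvPolynomial σ R} {n : ℕ}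
    (hp : p.IsHomogeneous n) {d : σ →₀ ℕ} (hd : coeff d p ≠ 0) : d.degree = n := by
  rw [Finsupp.degree_eq_weight_one]
  exact hp hd

/-! ### Homogeneity of `Φ` and closedness of the set of tangent planes -/

section Curve

variable {X : Set (Proj 4)}

/-- The dual surface is a cone, so the top component of `Φ` is a multiple of `Φ`; having the same
degree, it is a scalar multiple. -/
theorem IsSmoothSpaceCurve.isHomogeneous_of_dualIdeal_eq_span {Φ : MvPolynomial (Fin 4) ℂ}
    (hprime : Prime Φ) (hΦ : dualIdeal X = Ideal.span {Φ}) : Φ.IsHomogeneous Φ.totalDegree := by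
  set D := Φ.totalDegree
  have hmem : homogeneousComponent D Φ ∈ dualIdeal X := by
    have h : Φ ∈ dualIdeal X := hΦ ▸ Ideal.mem_span_singleton_self Φ
    rw [mem_dualIdeal] at h ⊢
    exact fun x hx y hy => eval_homogeneousComponent_eq_zero
      (fun c _ => h x hx _ (Submodule.smul_mem _ c hy)) D
  have hne : homogeneousComponent D Φ ≠ 0 := by
    obtain ⟨d, hd, hdD⟩ := Finset.exists_mem_eq_sup Φ.support
      (support_nonempty.mpr hprime.ne_zero) fun s => s.sum fun _ e => e
    intro h
    have := congrArg (coeff d) h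
    rw [coeff_homogeneousComponent, if_pos (show d.degree = D from hdD.symm), coeff_zero] at this
    exact mem_support_iff.mp hd this
  rw [hΦ, Ideal.mem_span_singleton] at hmem
  obtain ⟨k, hk⟩ := hmem
  have hk0 : k ≠ 0 := by
    rintro rfl
    exact hne (by rw [hk, mul_zero])
  have hdeg := (homogeneousComponent_isHomogeneous D Φ).totalDegree hne
  rw [hk, totalDegree_mul_of_isDomain hprime.ne_zero hk0] at hdeg
  have hkC := totalDegree_eq_zero_iff_eq_C.mp (show k.totalDegree = 0 by omega)
  set c := coeff 0 k
  have hc : c ≠ 0 := by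
    rintro h
    rw [hkC, h, C_0] at hk0
    exact hk0 rfl
  have : Φ = C c⁻¹ * homogeneousComponent D Φ := by
    rw [hk, hkC, mul_comm Φ, ← mul_assoc, ← C_mul, inv_mul_cancel₀ hc, C_1, one_mul]
  rw [this]
  exact (homogeneousComponent_isHomogeneous D Φ).C_mul _

/-- This turns tangency into polynomial equations in `x` and `h`: the determinants of `h`, two
gradients and a constant vector. They suffice because two gradients span the conormal space. -/
theorem IsSmoothSpaceCurve.mem_conormal_of_forall (hX : IsSmoothSpaceCurve X) {x h : Fin 4 → ℂ}
    (hx : x ∈ coords X) (H : ∀ f ∈ idealOf X, ∀ f' ∈ idealOf X, ∀ c,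
      cross4 (gradient f x) (gradient f' x) c ⬝ᵥ h = 0) : h ∈ conormal X x := by
  obtain ⟨u, hu, v, hv, huv, hspan⟩ := exists_basis_pair (hX.smooth x hx)
  obtain ⟨f, hf, rfl⟩ := mem_conormal.mp hu
  obtain ⟨f', hf', rfl⟩ := mem_conormal.mp hv
  rw [← hspan]
  by_contra hcon
  obtain ⟨c, hc⟩ := exists_det_ne_zero huv hcon
  rw [← cross4_dotProduct] at hc
  exact hc (H f hf f' hf' c)

/-- The polynomials in a point and a plane, with the coordinates of the plane as coefficients, 
that vanish whenever the plane is tangent to `X` at the point. -/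
def incidenceIdeal (X : Set (Proj 4)) : Ideal (MvPolynomial (Fin 4) (MvPolynomial (Fin 4) ℂ)) where
  carrier := {F | ∀ x ∈ coords X, ∀ h ∈ conormal X x, eval x (map (eval h) F) = 0}
  zero_mem' := by simp
  add_mem' := fun ha hb x hx h hh => by rw [map_add, map_add, ha x hx h hh, hb x hx h hh, add_zero]
  smul_mem' := fun c a ha x hx h hh => by
    rw [smul_eq_mul, map_mul, map_mul, ha x hx h hh, mul_zero]

theorem homogeneousComponent_mem_incidenceIdeal
    {F : MvPolynomial (Fin 4) (MvPolynomial (Fin 4) ℂ)} (hF : F ∈ incidenceIdeal X) (n : ℕ) :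
    homogeneousComponent n F ∈ incidenceIdeal X := by
  intro x hx h hh
  rw [map_homogeneousComponent]
  refine eval_homogeneousComponent_eq_zero (fun c hc => hF _ (smul_mem_coords hx hc) h ?_) n
  rwa [conormal_smul hc]

theorem IsSmoothSpaceCurve.mem_conormal_of_incidenceIdeal (hX : IsSmoothSpaceCurve X)
    {x h : Fin 4 → ℂ} (hx0 : x ≠ 0)
    (H : ∀ F ∈ incidenceIdeal X, eval x (map (eval h) F) = 0) : 
    x ∈ coords X ∧ h ∈ conormal X x := by
  have hmap : ∀ (h : Fin 4 → ℂ) (f : MvPolynomial (Fin 4) ℂ), map (eval h) (map C f) = f := by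
    intro h f
    rw [map_map]
    convert map_id f
    ext c
    simp
  have hx : x ∈ coords X := by
    refine hX.mem_coords.mpr ⟨hx0, fun f hf => ?_⟩
    have := H (map C f) fun y hy k hk => by
      rw [hmap]
      exact mem_idealOf.mp hf y hy
    rwa [hmap] at this
  refine ⟨hx, hX.mem_conormal_of_forall hx fun f hf f' hf' c => ?_⟩
  let v : Fin 4 → MvPolynomial (Fin 4) ℂ :=
    cross4 (fun i => pderiv i f) (fun i => pderiv i f') fun i => C (c i)
  have hv : ∀ x, (fun i => eval x (v i)) = cross4 (gradient f x) (gradient f' x) c := by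
    intro x
    rw [map_cross4]
    congr 1
    funext i
    simp
  have hF : ∀ x h, eval x (map (eval h) (∑ i, map C (v i) * C (MvPolynomial.X i))) =
      cross4 (gradient f x) (gradient f' x) c ⬝ᵥ h := by
    intro x h
    rw [← hv]
    simp only [map_sum, map_mul, hmap, map_C, eval_C, eval_X]
    rfl
  rw [← hF]
  refine H _ fun y hy k hk => ?_
  -- The determinant vanishes on the incidence variety because three vectors of a two-dimensional
  -- conormal space are dependent.
  rw [hF, cross4_dotProduct]
  by_contra hdet
  have hli := (Matrix.linearIndependent_rows_iff_isUnit.mpr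
    ((Matrix.isUnit_iff_isUnit_det _).mpr (Ne.isUnit hdet))).comp ![0, 1, 2] (by decide)
  have h3 : LinearIndependent ℂ (fun i : Fin 3 => (⟨![k, gradient f y, gradient f' y] i, by
      fin_cases i
      exacts [hk, mem_conormal.mpr ⟨f, hf, rfl⟩, mem_conormal.mpr ⟨f', hf', rfl⟩]⟩ :
        conormal X y)) := by
    refine LinearIndependent.of_comp (conormal X y).subtype ?_
    convert! hli using 1
    ext j : 1
    fin_cases j <;> rfl
  have := h3.fintype_card_le_finrank
  rw [hX.smooth y hy] at this
  simp at this

/-- The set of tangent planes of `X` is closed. -/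
theorem IsSmoothSpaceCurve.exists_mem_conormal (hX : IsSmoothSpaceCurve X) {h : Fin 4 → ℂ}
    (H : ∀ g ∈ dualIdeal X, eval h g = 0) : ∃ x ∈ coords X, h ∈ conormal X x := by
  by_contra! hcon
  let σ := map (σ := Fin 4) (eval h)
  have hσ : Function.Surjective σ := map_surjective _ fun c => ⟨C c, eval_C c⟩
  let J₀ := (incidenceIdeal X).map σ
  -- This is the elimination argument for properness of projective space. With no point of `X` over
  -- `h`, the specialized equations vanish at most at the origin, so they generate all forms of some
  -- degree `n`.
  have hrad : idealOfVars (Fin 4) ℂ ≤ J₀.radical := by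
    rw [← vanishingIdeal_zeroLocus_eq_radical (K := ℂ)]
    rw [idealOfVars, Ideal.span_le]
    rintro _ ⟨i, rfl⟩
    rw [SetLike.mem_coe, mem_vanishingIdeal_iff]
    intro x hx
    have hx0 : x = 0 := by
      by_contra hx0
      obtain ⟨h1, h2⟩ := hX.mem_conormal_of_incidenceIdeal hx0 (h := h) fun F hF => by
        rw [← aeval_eq_eval]
        exact hx _ (Ideal.mem_map_of_mem σ hF)
      exact hcon x h1 h2
    simp [hx0]
  obtain ⟨n, hn⟩ := Ideal.exists_pow_le_of_le_radical_of_fg hrad (idealOfVars_fg _ _)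
  let 𝔪 : Ideal (MvPolynomial (Fin 4) ℂ) := RingHom.ker (eval h)
  let P := homogeneousSubmodule (Fin 4) (MvPolynomial (Fin 4) ℂ) n
  let N := (incidenceIdeal X).restrictScalars (MvPolynomial (Fin 4) ℂ)
  -- A form of degree `n` agrees at `h` with one in the incidence ideal; the coefficients of the
  -- difference vanish at `h`.
  have hP : P ≤ N ⊔ 𝔪 • P := by
    intro F hF
    have hF' : σ F ∈ J₀ := by
      refine hn ((mem_pow_idealOfVars_iff _ _).mpr fun d hd => ?_)
      refine (degree_eq_of_isHomogeneous hF fun h0 => mem_support_iff.mp hd ?_).ge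
      rw [coeff_map, h0, map_zero]
    obtain ⟨j, hj, hjF⟩ := (Ideal.mem_map_iff_of_surjective σ hσ).mp hF'
    have hFn : homogeneousComponent n F = F := by
      rw [homogeneousComponent_of_mem hF, if_pos rfl]
    have hmap : σ (homogeneousComponent n j) = σ F := by
      rw [map_homogeneousComponent, hjF, ← map_homogeneousComponent, hFn]
    rw [← add_sub_cancel (homogeneousComponent n j) F]
    refine Submodule.add_mem_sup (homogeneousComponent_mem_incidenceIdeal hj n) ?_
    set E := F - homogeneousComponent n j
    have hE : E ∈ P := Submodule.sub_mem _ hF (homogeneousComponent_isHomogeneous n j)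
    have hE0 : σ E = 0 := by rw [map_sub, hmap, sub_self]
    rw [E.as_sum]
    refine Submodule.sum_mem _ fun d hd => ?_
    have : monomial d (coeff d E) = coeff d E • monomial d (1 : MvPolynomial (Fin 4) ℂ) := by
      rw [smul_monomial, smul_eq_mul, mul_one]
    rw [this]
    refine Submodule.smul_mem_smul ?_ ?_
    · rw [RingHom.mem_ker, ← coeff_map]
      change coeff d (σ E) = 0
      rw [hE0, coeff_zero]
    · exact isHomogeneous_monomial _ (degree_eq_of_isHomogeneous hE (mem_support_iff.mp hd))
  -- Nakayama's lemma: some `r` with `r h = 1` multiplies all forms of degree `n` into the incidence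
  -- ideal. Applied to the powers `X i ^ n`, this puts `r` in `dualIdeal X`, against `H`.
  obtain ⟨r, hr, hrP⟩ := Submodule.exists_sub_one_mem_and_smul_le_of_fg_of_le_sup
    (homogeneousSubmodule_fg (Fin 4) (MvPolynomial (Fin 4) ℂ) n) le_rfl hP
  have hr1 : eval h r = 1 := by
    rw [RingHom.mem_ker, map_sub, map_one, sub_eq_zero] at hr
    exact hr
  refine one_ne_zero (hr1.symm.trans (H r (mem_dualIdeal.mpr fun x hx k hk => ?_)))
  obtain ⟨i, hi⟩ := Function.ne_iff.mp (ne_zero_of_mem_coords hx)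
  have hXi : (MvPolynomial.X i : MvPolynomial (Fin 4) (MvPolynomial (Fin 4) ℂ)) ^ n ∈ P :=
    isHomogeneous_X_pow _ _ 
  have hmem : r • (MvPolynomial.X i : MvPolynomial (Fin 4) (MvPolynomial (Fin 4) ℂ)) ^ n ∈
    incidenceIdeal X := hrP (Submodule.smul_mem_pointwise_smul _ r P hXi)
  have := hmem x hx k hk
  rw [smul_eq_C_mul] at this
  simp at this
  exact this.resolve_right fun h => hi h.1

end Curve

/-! ### Transversality of a generic line to a hypersurface -/

/-- The restriction of a polynomial to the line `a + t b`, as a polynomial in `t`. -/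
def alongLine {n : ℕ} (a b : Fin n → ℂ) : MvPolynomial (Fin n) ℂ →ₐ[ℂ] Polynomial ℂ :=
  aeval fun i => Polynomial.C (a i) + Polynomial.X * Polynomial.C (b i)

theorem eval_alongLine {n : ℕ} (a b : Fin n → ℂ) (f : MvPolynomial (Fin n) ℂ) (t : ℂ) :
    (alongLine a b f).eval t = eval (a + t • b) f := by
  have : (Polynomial.evalRingHom t).comp (alongLine a b).toRingHom = eval (a + t • b) := by
    ext i
    · simp [alongLine]
    · simp [alongLine]
      ring
  exact congrArg (fun φ => φ f) this

/-- The polynomial ring in two vectors of indeterminates. -/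
abbrev PairRing (n : ℕ) : Type := MvPolynomial (Fin n) (MvPolynomial (Fin n) ℂ)

/-- Evaluation of a polynomial in two vectors of indeterminates. -/
def evalPair {n : ℕ} (a b : Fin n → ℂ) : PairRing n →+* ℂ := (eval b).comp (map (eval a))

/-- The restriction of a polynomial to the generic line. -/
def alongGenericLine (n : ℕ) (ε : ℂ) : MvPolynomial (Fin n) ℂ →ₐ[ℂ] Polynomial (PairRing n) :=
  aeval fun i => Polynomial.C (C (X i)) + algebraMap ℂ _ ε * (Polynomial.X * Polynomial.C (X i))

/-- The automorphism `a ↦ a + ε t b` of the polynomial ring in `a`, `b` and `t`. -/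
def shear (n : ℕ) (ε : ℂ) : Polynomial (PairRing n) →+* Polynomial (PairRing n) :=
  Polynomial.eval₂RingHom
    (eval₂Hom (alongGenericLine n ε).toRingHom fun i => Polynomial.C (X i)) Polynomial.X

theorem shear_C_C (n : ℕ) (ε : ℂ) (f : MvPolynomial (Fin n) ℂ) :
    shear n ε (Polynomial.C (C f)) = alongGenericLine n ε f := by
  simp [shear]

theorem shear_algebraMap (n : ℕ) (ε c : ℂ) : 
    shear n ε (algebraMap ℂ (Polynomial (PairRing n)) c) = algebraMap ℂ _ c := by
  have : algebraMap ℂ (Polynomial (PairRing n)) c = Polynomial.C (C (C c)) := rfl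
  conv_lhs => rw [this, shear_C_C]
  exact (alongGenericLine n ε).commutes c

theorem shear_comp_shear_neg (n : ℕ) (ε : ℂ) :
    (shear n ε).comp (shear n (-ε)) = RingHom.id _ := by
  refine Polynomial.ringHom_ext' (MvPolynomial.ringHom_ext' (MvPolynomial.ringHom_ext' ?_ ?_) ?_) ?_
  · ext c
    simp [shear, alongGenericLine]
  · intro i
    have : shear n ε (shear n (-ε) (Polynomial.C (C (X i)))) = Polynomial.C (C (X i)) := by
      rw [shear_C_C, alongGenericLine, aeval_X, map_add, shear_C_C, map_mul, shear_algebraMap,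
        alongGenericLine, aeval_X]
      simp [shear]
      ring
    exact this
  · intro i
    simp [shear]
  · simp [shear]

/-- The shear is an automorphism, with inverse given by `-ε`, and carries the prime `Φ (a)` to `Φ (a
+ t b)`. -/
theorem prime_alongGenericLine {n : ℕ} {Φ : MvPolynomial (Fin n) ℂ} (hΦ : Prime Φ) :
    Prime (alongGenericLine n 1 Φ) := by
  let e : Polynomial (PairRing n) ≃+* Polynomial (PairRing n) :=
    RingEquiv.ofRingHom (shear n 1) (shear n (-1)) (shear_comp_shear_neg n 1) (by
      have := shear_comp_shear_neg n (-1)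
      rwa [neg_neg] at this)
  have h : e (Polynomial.C (C Φ)) = alongGenericLine n 1 Φ := shear_C_C n 1 Φ
  rw [← h, MulEquiv.prime_iff, Polynomial.prime_C_iff, MvPolynomial.prime_C_iff]
  exact hΦ

theorem map_alongGenericLine {n : ℕ} (a b : Fin n → ℂ) (f : MvPolynomial (Fin n) ℂ) :
    (alongGenericLine n 1 f).map (evalPair a b) = alongLine a b f := by
  have : (Polynomial.mapRingHom (evalPair a b)).comp (alongGenericLine n 1).toRingHom =
      (alongLine a b).toRingHom := by
    ext i
    · have h : alongGenericLine n 1 (C i) = Polynomial.C (C (C i)) :=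
        (alongGenericLine n 1).commutes i
      have h' : alongLine a b (C i) = Polynomial.C i := (alongLine a b).commutes i
      simp [h, h', evalPair]
    · simp [alongGenericLine, alongLine, evalPair]
  exact congrArg (fun φ => φ f) this

/-- A generic line meets an irreducible hypersurface transversally. -/
theorem exists_separable_alongLine {n : ℕ} {Φ : MvPolynomial (Fin n) ℂ} (hΦ : Prime Φ) :
    ∃ r : PairRing n, r ≠ 0 ∧
      ∀ a b : Fin n → ℂ, evalPair a b r ≠ 0 → (alongLine a b Φ).Separable := by
  set P := alongGenericLine n 1 Φ with hP
  have hprime : Prime P := prime_alongGenericLine hΦ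
  -- Otherwise `Φ` is constant on every line through the origin, hence constant.
  have hdeg : P.natDegree ≠ 0 := by
    intro h
    have hline : ∀ b : Fin n → ℂ, eval b Φ = eval 0 Φ := by
      intro b
      have h0 : (alongLine 0 b Φ).natDegree = 0 := by
        rw [← map_alongGenericLine, ← hP, Polynomial.eq_C_of_natDegree_eq_zero h]
        simp
      have h1 := eval_alongLine 0 b Φ 1
      have h2 := eval_alongLine 0 b Φ 0
      rw [Polynomial.eq_C_of_natDegree_eq_zero h0, Polynomial.eval_C] at h1 h2
      simpa using h1.symm.trans h2
    have hC : Φ = C (eval 0 Φ) := MvPolynomial.funext fun b => by rw [hline, eval_C]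
    by_cases h0 : eval 0 Φ = 0
    · rw [h0, C_0] at hC
      exact hΦ.ne_zero hC
    · refine hΦ.not_isUnit ?_
      rw [hC]
      exact (Ne.isUnit h0).map C
  let K := FractionRing (PairRing n)
  -- Gauss's lemma gives irreducibility over the fraction field, where characteristic zero gives
  -- separability. Clearing denominators in the Bézout identity produces the exceptional polynomial
  -- `c * d`.
  have hirr : Irreducible (P.map (algebraMap (PairRing n) K)) :=
    (Polynomial.IsPrimitive.irreducible_iff_irreducible_map_fraction_map
      (hprime.irreducible.isPrimitive hdeg)).mp hprime.irreducible
  obtain ⟨u, v, huv⟩ := hirr.separable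
  obtain ⟨c, hc0, hc⟩ := IsLocalization.integerNormalization_spec (nonZeroDivisors (PairRing n)) u
  obtain ⟨d, hd0, hd⟩ := IsLocalization.integerNormalization_spec (nonZeroDivisors (PairRing n)) v
  set u' := IsLocalization.integerNormalization (nonZeroDivisors (PairRing n)) u
  set v' := IsLocalization.integerNormalization (nonZeroDivisors (PairRing n)) v
  have key : Polynomial.C d * u' * P + Polynomial.C c * v' * P.derivative =
      Polynomial.C (c * d) := by
    apply Polynomial.map_injective (algebraMap (PairRing n) K) (IsFractionRing.injective _ _)
    simp only [Polynomial.map_add, Polynomial.map_mul, hc, hd, Polynomial.map_C,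
      ← Polynomial.derivative_map]
    simp only [Algebra.smul_def, Polynomial.algebraMap_apply, map_mul]
    linear_combination Polynomial.C (algebraMap (PairRing n) K c) *
      Polynomial.C (algebraMap (PairRing n) K d) * huv
  refine ⟨c * d, mul_ne_zero (nonZeroDivisors.ne_zero hc0) (nonZeroDivisors.ne_zero hd0),
    fun a b hab => ?_⟩
  have h := congrArg (Polynomial.map (evalPair a b)) key
  simp only [Polynomial.map_add, Polynomial.map_mul, Polynomial.map_C,
    ← Polynomial.derivative_map, P, map_alongGenericLine] at h
  have hu : IsUnit (Polynomial.C (evalPair a b (c * d))) := (Ne.isUnit hab).map Polynomial.C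
  obtain ⟨w, hw⟩ := hu.exists_left_inv
  refine ⟨w * (Polynomial.C (evalPair a b d) * Polynomial.map (evalPair a b) u'),
    w * (Polynomial.C (evalPair a b c) * Polynomial.map (evalPair a b) v'), ?_⟩
  rw [← hw, ← h]
  ring

/-! ### Polynomials of least degree and their derivatives -/

theorem exists_pderiv_ne_zero {n : ℕ} {f : MvPolynomial (Fin n) ℂ} (hf : f.totalDegree ≠ 0) :
    ∃ i, pderiv i f ≠ 0 ∧ (pderiv i f).totalDegree < f.totalDegree := by
  obtain ⟨d, hd, hdi⟩ : ∃ d ∈ f.support, d ≠ 0 := by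
    by_contra! h
    refine hf (Nat.eq_zero_of_le_zero (Finset.sup_le fun d hd => ?_))
    simp [h d hd]
  obtain ⟨i, hi⟩ := Finsupp.ne_iff.mp hdi
  refine ⟨i, fun h => ?_, ?_⟩
  · have := congrArg (coeff (d - Finsupp.single i 1)) h
    rw [coeff_pderiv, coeff_zero] at this
    have hle : Finsupp.single i 1 ≤ d := by
      rw [Finsupp.single_le_iff]
      exact Nat.one_le_iff_ne_zero.mpr hi
    rw [tsub_add_cancel_of_le hle] at this
    refine mul_ne_zero (mem_support_iff.mp hd) ?_ this
    exact Nat.cast_add_one_ne_zero _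
  · refine (Finset.sup_lt_iff (Nat.pos_of_ne_zero hf)).mpr fun m hm => ?_
    rw [mem_support_iff, coeff_pderiv] at hm
    have := le_totalDegree (mem_support_iff.mpr (left_ne_zero_of_mul hm))
    rw [Finsupp.sum_add_index' (by simp) (by simp)] at this
    simp at this
    exact this

/-! ### The dual curve of an image as a plane section of the dual surface -/

section Camera

variable {X : Set (Proj 4)} {M : Matrix (Fin 3) (Fin 4) ℂ} {O : Fin 4 → ℂ}

theorem IsCamera.ker_eq (hM : IsCamera M O) : LinearMap.ker M.mulVecLin = Submodule.span ℂ {O} := by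
  refine (Submodule.eq_of_le_of_finrank_le ?_ ?_).symm
  · rw [Submodule.span_singleton_le_iff_mem]
    exact hM.2.2
  · have := LinearMap.finrank_range_add_finrank_ker M.mulVecLin
    rw [← Matrix.rank, hM.1, Module.finrank_fin_fun] at this
    rw [finrank_span_singleton hM.2.1]
    omega

theorem IsCamera.exists_rightInverse (hM : IsCamera M O) :
    ∃ R : Matrix (Fin 4) (Fin 3) ℂ, M * R = 1 := by
  rw [← Matrix.mulVec_surjective_iff_exists_right_inverse]
  have : LinearMap.range M.mulVecLin = ⊤ :=
    Submodule.eq_top_of_finrank_eq (by rw [← Matrix.rank, hM.1, Module.finrank_fin_fun])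
  exact LinearMap.range_eq_top.mp this

theorem IsCamera.transpose_mulVec_injective (hM : IsCamera M O) :
    Function.Injective Mᵀ.mulVec := by
  obtain ⟨R, hR⟩ := hM.exists_rightInverse
  refine Function.LeftInverse.injective (g := Rᵀ.mulVec) fun l => ?_
  rw [Matrix.mulVec_mulVec, ← Matrix.transpose_mul, hR, Matrix.transpose_one, Matrix.one_mulVec]

theorem IsCamera.transpose_mulVec_dotProduct (hM : IsCamera M O) (l : Fin 3 → ℂ) :
    (Mᵀ *ᵥ l) ⬝ᵥ O = 0 := by
  rw [Matrix.mulVec_transpose, ← Matrix.dotProduct_mulVec, hM.2.2, dotProduct_zero]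

/-- By rank, the planes of sight of image lines are all the planes through the center. -/
theorem IsCamera.exists_transpose_mulVec_eq (hM : IsCamera M O) {h : Fin 4 → ℂ}
    (hO : h ⬝ᵥ O = 0) : ∃ l, Mᵀ *ᵥ l = h := by
  have hle : LinearMap.range Mᵀ.mulVecLin ≤ perp (Submodule.span ℂ {O}) := by
    rintro _ ⟨l, rfl⟩
    rw [mem_perp_span]
    rintro _ rfl
    exact hM.transpose_mulVec_dotProduct l
  have heq := Submodule.eq_of_le_of_finrank_le hle (by
    have h1 := finrank_perp (Submodule.span ℂ {O})
    rw [finrank_span_singleton hM.2.1] at h1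
    rw [← Matrix.rank, Matrix.rank_transpose, hM.1]
    omega)
  have hmem : h ∈ perp (Submodule.span ℂ {O}) := by
    rw [mem_perp_span]
    rintro _ rfl
    exact hO
  rw [← heq] at hmem
  exact hmem

/-- The hypothesis `hO` says that the center is on no tangent line of `X`. By Euler's formula each
point of `X` is on its own tangent line, so the center is not on `X`. -/
theorem IsCamera.mulVec_ne_zero (hM : IsCamera M O)
    (hO : ∀ x ∈ coords X, O ∉ perp (conormal X x)) {x : Fin 4 → ℂ} (hx : x ∈ coords X) :
    M *ᵥ x ≠ 0 := by
  intro h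
  have hker : x ∈ LinearMap.ker M.mulVecLin := h
  rw [hM.ker_eq] at hker
  obtain ⟨c, rfl⟩ := Submodule.mem_span_singleton.mp hker
  have hc : c ≠ 0 := by
    rintro rfl
    exact ne_zero_of_mem_coords hx (zero_smul _ _)
  refine hO _ hx fun w hw => ?_
  have := mem_conormal_dotProduct_self hw hx
  rw [dotProduct_smul, smul_eq_zero, dotProduct_comm] at this
  exact this.resolve_left hc

theorem mem_coords_imageCurve {y : Fin 3 → ℂ} :
    y ∈ coords (imageCurve M X) ↔ y ≠ 0 ∧ ∃ x ∈ coords X, y = M *ᵥ x := by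
  constructor
  · rintro ⟨hy, x, hx, hMx, h⟩
    obtain ⟨c, hc⟩ := (Projectivization.mk_eq_mk_iff ℂ y _ hy hMx).mp h
    refine ⟨hy, (c : ℂ) • x, smul_mem_coords hx c.ne_zero, ?_⟩
    rw [Matrix.mulVec_smul, ← hc]
    rfl
  · rintro ⟨hy, x, hx, rfl⟩
    exact ⟨hy, x, hx, hy, rfl⟩

theorem pullback_mem_idealOf (hM : IsCamera M O) (hO : ∀ x ∈ coords X, O ∉ perp (conormal X x))
    {f : MvPolynomial (Fin 3) ℂ} : pullback M f ∈ idealOf X ↔ f ∈ idealOf (imageCurve M X) := by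
  simp only [mem_idealOf, eval_pullback, mem_coords_imageCurve]
  constructor
  · rintro h _ ⟨_, x, hx, rfl⟩
    exact h x hx
  · intro h x hx
    exact h _ ⟨hM.mulVec_ne_zero hO hx, x, hx, rfl⟩

/-- The image curve is generically smooth: some partial derivative of some polynomial vanishing on
it does not vanish identically on it. -/
theorem IsSmoothSpaceCurve.exists_pderiv_notMem (hX : IsSmoothSpaceCurve X) (hM : IsCamera M O)
    (hO : ∀ x ∈ coords X, O ∉ perp (conormal X x)) :
    ∃ f ∈ idealOf (imageCurve M X), ∃ i, pderiv i f ∉ idealOf (imageCurve M X) := by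
  -- Three variables cannot embed in the two-dimensional coordinate ring of the cone.
  have hne : ∃ f ∈ idealOf (imageCurve M X), f ≠ 0 := by
    by_contra! hcon
    have hinj : Function.Injective ((Ideal.Quotient.mkₐ ℂ (idealOf X)).comp (pullback M)) := by
      rw [injective_iff_map_eq_zero]
      intro f hf
      refine hcon f ((pullback_mem_idealOf hM hO).mp ?_)
      exact Ideal.Quotient.eq_zero_iff_mem.mp hf
    have h3 := natCast_le_ringKrullDim_of_injective (n := 3) _ hinj
    rw [hX.dim_one] at h3
    have : ((3 : ℕ) : WithBot ℕ∞) ≤ (2 : ℕ) := h3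
    exact absurd (Nat.cast_le.mp this) (by norm_num)
  classical
  -- A nonzero polynomial of least degree in the ideal has a nonzero derivative of smaller degree,
  -- which cannot be in the ideal.
  have hex : ∃ d, ∃ f ∈ idealOf (imageCurve M X), f ≠ 0 ∧ f.totalDegree = d := by
    obtain ⟨f, hf, hf0⟩ := hne
    exact ⟨_, f, hf, hf0, rfl⟩
  obtain ⟨f, hf, hf0, hfd⟩ := Nat.find_spec hex
  have hd : f.totalDegree ≠ 0 := by
    intro h
    rw [totalDegree_eq_zero_iff_eq_C] at h
    obtain ⟨x, hx⟩ := hX.coords_nonempty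
    have := mem_idealOf.mp hf _ (mem_coords_imageCurve.mpr ⟨hM.mulVec_ne_zero hO hx, x, hx, rfl⟩)
    rw [h, eval_C] at this
    rw [h, this, C_0] at hf0
    exact hf0 rfl
  obtain ⟨i, hi, hlt⟩ := exists_pderiv_ne_zero hd
  refine ⟨f, hf, i, fun hmem => ?_⟩
  rw [hfd] at hlt
  exact Nat.find_min hex hlt ⟨_, hmem, hi, rfl⟩

/-- Pairing with `O` is a nonzero form on the two-dimensional `W`, so its kernel is a line. -/
theorem exists_smul_eq_of_dotProduct_eq_zero {W : Submodule ℂ (Fin 4 → ℂ)}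
    (hW : Module.finrank ℂ W = 2) (hO : O ∉ perp W) {u v : Fin 4 → ℂ} (hu : u ∈ W) (hv : v ∈ W)
    (hu0 : u ≠ 0) (huO : u ⬝ᵥ O = 0) (hvO : v ⬝ᵥ O = 0) : ∃ c : ℂ, v = c • u := by
  by_contra! hcon
  have hli : LinearIndependent ℂ ![u, v] :=
    (LinearIndependent.pair_iff' hu0).mpr fun c h => hcon c h.symm
  have hs : Submodule.span ℂ {u, v} = W := by
    refine Submodule.eq_of_le_of_finrank_le ?_ ?_
    · rw [Submodule.span_le]
      rintro _ (rfl | rfl) <;> assumption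
    · rw [hW, finrank_span_pair hli]
  apply hO
  rw [← hs, mem_perp_span]
  rintro w (rfl | rfl) <;> rwa [dotProduct_comm]

theorem transpose_mulVec_mem_conormal (hM : IsCamera M O)
    (hO : ∀ x ∈ coords X, O ∉ perp (conormal X x)) {x : Fin 4 → ℂ} {w : Fin 3 → ℂ}
    (hw : w ∈ conormal (imageCurve M X) (M *ᵥ x)) : Mᵀ *ᵥ w ∈ conormal X x := by
  obtain ⟨k, hk, rfl⟩ := mem_conormal.mp hw
  rw [← gradient_pullback]
  exact mem_conormal.mpr ⟨_, (pullback_mem_idealOf hM hO).mpr hk, rfl⟩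

/-- `Mᵀ` embeds the conormal space of the image into the conormal vectors of `X` orthogonal to the
center, which form a line. -/
theorem conormal_imageCurve (hX : IsSmoothSpaceCurve X) (hM : IsCamera M O)
    (hO : ∀ x ∈ coords X, O ∉ perp (conormal X x)) {x : Fin 4 → ℂ} (hx : x ∈ coords X)
    {l : Fin 3 → ℂ} (hl : l ∈ conormal (imageCurve M X) (M *ᵥ x)) (hl0 : l ≠ 0) :
    conormal (imageCurve M X) (M *ᵥ x) = Submodule.span ℂ {l} := by
  refine le_antisymm (fun w hw => ?_) ((Submodule.span_singleton_le_iff_mem _ _).mpr hl)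
  have hMl : Mᵀ *ᵥ l ≠ 0 := by
    intro h
    exact hl0 (hM.transpose_mulVec_injective (h.trans (Matrix.mulVec_zero _).symm))
  obtain ⟨c, hc⟩ := exists_smul_eq_of_dotProduct_eq_zero (hX.smooth x hx) (hO x hx)
    (transpose_mulVec_mem_conormal hM hO hl) (transpose_mulVec_mem_conormal hM hO hw) hMl
    (hM.transpose_mulVec_dotProduct l) (hM.transpose_mulVec_dotProduct w)
  rw [← Matrix.mulVec_smul] at hc
  exact Submodule.mem_span_singleton.mpr ⟨c, (hM.transpose_mulVec_injective hc).symm⟩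

theorem eval_smul_eq_zero_of_mem_coords {n : ℕ} {S : Set (Proj n)} {g : MvPolynomial (Fin n) ℂ}
    (hg : g ∈ idealOf S) {l : Fin n → ℂ} (hl : l ∈ coords S) (c : ℂ) : eval (c • l) g = 0 := by
  have h : alongLine 0 l g = 0 := by
    refine Polynomial.eq_zero_of_infinite_isRoot _ (Set.Infinite.mono (s := {0}ᶜ) (fun t ht => ?_)
      (Set.finite_singleton _).infinite_compl)
    rw [Set.mem_ofPred_eq, Polynomial.IsRoot.def, eval_alongLine, zero_add]
    exact mem_idealOf.mp hg _ (smul_mem_coords hl ht)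
  have := eval_alongLine 0 l g c
  rwa [h, Polynomial.eval_zero, zero_add, eq_comm] at this

/-- A polynomial vanishing on the tangent lines of the image curve vanishes on the images of all
tangent planes through the center. -/
theorem IsSmoothSpaceCurve.eval_eq_zero_of_mem_idealOf_tangentLines (hX : IsSmoothSpaceCurve X)
    (hM : IsCamera M O) (hO : ∀ x ∈ coords X, O ∉ perp (conormal X x))
    {g : MvPolynomial (Fin 3) ℂ} (hg : g ∈ idealOf (tangentLines (imageCurve M X)))
    {x : Fin 4 → ℂ} (hx : x ∈ coords X) {l : Fin 3 → ℂ} (hl : Mᵀ *ᵥ l ∈ conormal X x) :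
    eval l g = 0 := by
  obtain ⟨f, hf, i, hi⟩ := hX.exists_pderiv_notMem hM hO
  obtain ⟨R, hR⟩ := hM.exists_rightInverse
  have hRM : ∀ l, Rᵀ *ᵥ (Mᵀ *ᵥ l) = l := fun l => by
    rw [Matrix.mulVec_mulVec, ← Matrix.transpose_mul, hR, Matrix.transpose_one, Matrix.one_mulVec]
  obtain ⟨f₂, hf₂, hlf₂⟩ := mem_conormal.mp hl
  obtain ⟨f₁, hf₁, hf₁O⟩ : ∃ f₁ ∈ idealOf X, gradient f₁ x ⬝ᵥ O = 1 := by
    by_contra! hcon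
    refine hO x hx fun w hw => ?_
    rw [dotProduct_comm]
    obtain ⟨k, hk, rfl⟩ := mem_conormal.mp hw
    by_contra hne
    refine hcon (C (gradient k x ⬝ᵥ O)⁻¹ * k) (Ideal.mul_mem_left _ _ hk) ?_
    rw [gradient_smul, smul_dotProduct, smul_eq_mul, inv_mul_cancel₀ hne]
  -- `N` is a conormal vector orthogonal to `O`, depending polynomially on the point and equal to
  -- `Mᵀ l` at `x`; `L` is its image line. Where `pderiv i f` is nonzero, `L` is a multiple of the
  -- true tangent line, so `g ∘ L` vanishes; irreducibility carries this to `x`.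
  let N : Fin 4 → MvPolynomial (Fin 4) ℂ := fun j =>
    (∑ m, C (O m) * pderiv m f₁) * pderiv j f₂ - (∑ m, C (O m) * pderiv m f₂) * pderiv j f₁
  let L : Fin 3 → MvPolynomial (Fin 4) ℂ := fun k => ∑ j, C (R j k) * N j
  have hN : ∀ y, (fun j => eval y (N j)) =
      (gradient f₁ y ⬝ᵥ O) • gradient f₂ y - (gradient f₂ y ⬝ᵥ O) • gradient f₁ y := by
    intro y
    funext j
    simp [N, gradient, dotProduct, mul_comm]
  have hL : ∀ y, eval y (bind₁ L g) = eval (Rᵀ *ᵥ fun j => eval y (N j)) g := by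
    intro y
    have : (fun k => eval y (L k)) = Rᵀ *ᵥ fun j => eval y (N j) := by
      funext k
      simp [L, Matrix.mulVec, dotProduct]
    rw [← this, ← aeval_eq_eval, aeval_bind₁]
    rfl
  have hgood : ∀ y ∈ coords X, eval (M *ᵥ y) (pderiv i f) ≠ 0 → eval y (bind₁ L g) = 0 := by
    intro y hy hne
    set l' := gradient f (M *ᵥ y)
    have hl'0 : l' ≠ 0 := fun h => hne (congrFun h i)
    have hl' : l' ∈ conormal (imageCurve M X) (M *ᵥ y) := mem_conormal.mpr ⟨f, hf, rfl⟩
    have hcoords : l' ∈ coords (tangentLines (imageCurve M X)) :=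
      ⟨hl'0, M *ᵥ y, mem_coords_imageCurve.mpr ⟨hM.mulVec_ne_zero hO hy, y, hy, rfl⟩, l', hl'0,
        conormal_imageCurve hX hM hO hy hl' hl'0, rfl⟩
    have hMl' : Mᵀ *ᵥ l' ≠ 0 := fun h =>
      hl'0 (hM.transpose_mulVec_injective (h.trans (Matrix.mulVec_zero _).symm))
    obtain ⟨c, hc⟩ := exists_smul_eq_of_dotProduct_eq_zero (hX.smooth y hy) (hO y hy)
      (transpose_mulVec_mem_conormal hM hO hl') (v := fun j => eval y (N j))
      (by
        rw [hN]
        exact Submodule.sub_mem _ (Submodule.smul_mem _ _ (mem_conormal.mpr ⟨f₂, hf₂, rfl⟩))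
          (Submodule.smul_mem _ _ (mem_conormal.mpr ⟨f₁, hf₁, rfl⟩))) hMl'
      (hM.transpose_mulVec_dotProduct l')
      (by
        rw [hN, sub_dotProduct, smul_dotProduct, smul_dotProduct, smul_eq_mul, smul_eq_mul]
        ring)
    rw [hL, hc, Matrix.mulVec_smul, hRM]
    exact eval_smul_eq_zero_of_mem_coords hg hcoords c
  have hmem : pullback M (pderiv i f) * bind₁ L g ∈ idealOf X := by
    rw [mem_idealOf]
    intro y hy
    rw [map_mul, eval_pullback]
    by_cases h : eval (M *ᵥ y) (pderiv i f) = 0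
    · rw [h, zero_mul]
    · rw [hgood y hy h, mul_zero]
  have hk := (hX.irreducible.mem_or_mem hmem).resolve_left fun h =>
    hi ((pullback_mem_idealOf hM hO).mp h)
  have := mem_idealOf.mp hk x hx
  rw [hL, hN, hf₁O, ← hlf₂, hM.transpose_mulVec_dotProduct, zero_smul, sub_zero, one_smul,
    hRM] at this
  exact this

/-- A tangent line of the image pulls back to a tangent plane of `X`. Conversely, a zero of `Φ ∘ Mᵀ`
comes from a tangent plane by closedness, so the Nullstellensatz gives the ideal up to radical, and
squarefreeness removes the radical. -/
theorem IsSmoothSpaceCurve.idealOf_dualCurve (hX : IsSmoothSpaceCurve X) (hM : IsCamera M O)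
    (hO : ∀ x ∈ coords X, O ∉ perp (conormal X x)) {Φ : MvPolynomial (Fin 4) ℂ}
    (hΦ : dualIdeal X = Ideal.span {Φ}) (hsq : Squarefree (pullback Mᵀ Φ)) :
    Ideal.span {pullback Mᵀ Φ} = idealOf (dualCurve (imageCurve M X)) := by
  have hΦmem : Φ ∈ dualIdeal X := hΦ ▸ Ideal.mem_span_singleton_self Φ
  rw [dualCurve, idealOf_zariskiClosure]
  refine le_antisymm ?_ fun g hg => ?_
  · rw [Ideal.span_singleton_le_iff_mem, mem_idealOf]
    rintro y ⟨hy, v, hv, l, hl, hvl, hyl⟩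
    obtain ⟨c, rfl⟩ := (Projectivization.mk_eq_mk_iff ℂ y _ hy hl).mp hyl
    obtain ⟨-, x, hx, rfl⟩ := mem_coords_imageCurve.mp hv
    rw [eval_pullback]
    refine mem_dualIdeal.mp hΦmem x hx _ (transpose_mulVec_mem_conormal hM hO ?_)
    rw [hvl]
    exact Submodule.smul_mem _ _ (Submodule.mem_span_singleton_self l)
  · have hrad : g ∈ (Ideal.span {pullback Mᵀ Φ}).radical := by
      rw [← vanishingIdeal_zeroLocus_eq_radical (K := ℂ), mem_vanishingIdeal_iff]
      intro l hl
      have hl0 := hl _ (Ideal.mem_span_singleton_self _)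
      rw [aeval_eq_eval] at hl0 ⊢
      change eval l _ = 0 at hl0
      rw [eval_pullback] at hl0
      obtain ⟨x, hx, hlx⟩ := hX.exists_mem_conormal (h := Mᵀ *ᵥ l) fun k hk => by
        rw [hΦ, Ideal.mem_span_singleton] at hk
        obtain ⟨q, rfl⟩ := hk
        rw [map_mul, hl0, zero_mul]
      exact hX.eval_eq_zero_of_mem_idealOf_tangentLines hM hO hg hx hlx
    obtain ⟨n, hn⟩ := hrad
    rw [Ideal.mem_span_singleton] at hn ⊢
    -- The exponent is raised to `n + 1` because `n` may be zero.
    exact (hsq.dvd_pow_iff_dvd (Nat.succ_ne_zero n)).mp (hn.trans (pow_dvd_pow _ n.le_succ))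

end Camera

/-! ### Restriction to lines -/

theorem natDegree_alongLine_le {n : ℕ} (a b : Fin n → ℂ) (f : MvPolynomial (Fin n) ℂ) :
    (alongLine a b f).natDegree ≤ f.totalDegree := by
  have := MvPolynomial.aeval_natDegree_le f le_rfl
    (fun i => Polynomial.C (a i) + Polynomial.X * Polynomial.C (b i)) (n := 1) fun i => by
      compute_degree
  simpa [alongLine] using this

theorem alongLine_pullback {m n : ℕ} (M : Matrix (Fin m) (Fin n) ℂ) (a b : Fin n → ℂ)
    (f : MvPolynomial (Fin m) ℂ) :
    alongLine a b (pullback M f) = alongLine (M *ᵥ a) (M *ᵥ b) f := by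
  refine Polynomial.funext fun t => ?_
  rw [eval_alongLine, eval_pullback, eval_alongLine, Matrix.mulVec_add, Matrix.mulVec_smul]

theorem alongLine_smul {n D : ℕ} {Φ : MvPolynomial (Fin n) ℂ} (hΦ : Φ.IsHomogeneous D) (c : ℂ)
    (a b : Fin n → ℂ) :
    alongLine (c • a) (c • b) Φ = Polynomial.C (c ^ D) * alongLine a b Φ := by
  refine Polynomial.funext fun t => ?_
  rw [Polynomial.eval_mul, Polynomial.eval_C, eval_alongLine, eval_alongLine, smul_comm t c,
    ← smul_add, eval_smul_of_isHomogeneous hΦ]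

/-- Reversing the coefficients of `Φ (a + t b)` exchanges `a` and `b`, so the top coefficient is the
constant term of `Φ (b + t a)`. -/
theorem coeff_alongLine {n D : ℕ} {Φ : MvPolynomial (Fin n) ℂ} (hΦ : Φ.IsHomogeneous D)
    (a b : Fin n → ℂ) : (alongLine a b Φ).coeff D = eval b Φ := by
  have hdeg : (alongLine a b Φ).natDegree ≤ D :=
    (natDegree_alongLine_le a b Φ).trans hΦ.totalDegree_le
  have h : (alongLine a b Φ).reflect D = alongLine b a Φ := by
    refine Polynomial.eq_of_infinite_eval_eq _ _ (Set.Infinite.mono (s := {0}ᶜ) (fun t ht => ?_)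
      (Set.finite_singleton _).infinite_compl)
    have ht0 : t ≠ 0 := ht
    let _ := invertibleOfNonzero (inv_ne_zero ht0)
    have h1 := Polynomial.eval₂_reflect_mul_pow (RingHom.id ℂ) t⁻¹ D _ hdeg
    simp only [invOf_eq_inv, inv_inv, Polynomial.eval₂_id] at h1
    rw [eval_alongLine] at h1
    rw [Set.mem_ofPred_eq, eval_alongLine]
    have h2 : b + t • a = t • (a + t⁻¹ • b) := by
      rw [smul_add, smul_smul, mul_inv_cancel₀ ht0, one_smul, add_comm]
    rw [h2, eval_smul_of_isHomogeneous hΦ, ← h1, inv_pow]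
    field_simp
  have h0 := congrArg (fun p => Polynomial.coeff p 0) h
  simp only [Polynomial.coeff_reflect, Polynomial.revAt_le (Nat.zero_le D), Nat.sub_zero] at h0
  rw [h0, Polynomial.coeff_zero_eq_eval_zero, eval_alongLine, zero_smul, add_zero]

/-- A repeated factor becomes constant on the line. Since `f` loses no degree there, neither does
the factor, so it was constant already. -/
theorem squarefree_of_squarefree_alongLine {n : ℕ} {f : MvPolynomial (Fin n) ℂ} (hf : f ≠ 0)
    {a b : Fin n → ℂ} (hsq : Squarefree (alongLine a b f))
    (hdeg : f.totalDegree ≤ (alongLine a b f).natDegree) : Squarefree f := by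
  rintro q ⟨s, rfl⟩
  have hqq := left_ne_zero_of_mul hf
  have hq := left_ne_zero_of_mul hqq
  have hs := right_ne_zero_of_mul hf
  have hunit : IsUnit (alongLine a b q) := hsq _ ⟨alongLine a b s, by rw [map_mul, map_mul]⟩
  have h0 := Polynomial.natDegree_eq_zero_of_isUnit hunit
  rw [totalDegree_mul_of_isDomain hqq hs, totalDegree_mul_of_isDomain hq hq, map_mul, map_mul]
    at hdeg
  have h1 := hdeg.trans (Polynomial.natDegree_mul_le.trans
    (Nat.add_le_add_right Polynomial.natDegree_mul_le _))
  have h2 := natDegree_alongLine_le a b s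
  have hC := totalDegree_eq_zero_iff_eq_C.mp (show q.totalDegree = 0 by omega)
  rw [hC] at hq ⊢
  exact (Ne.isUnit fun h => hq (by rw [h, C_0])).map C

/-! ### Generic pencils of planes -/

theorem exists_evalPair_ne_zero {n : ℕ} {r : PairRing n} (hr : r ≠ 0) :
    ∃ a b, evalPair a b r ≠ 0 := by
  by_contra! h
  apply hr
  ext d : 1
  refine MvPolynomial.funext fun a => ?_
  have : map (eval a) r = 0 := MvPolynomial.funext fun b => by
    rw [map_zero]
    exact h a b
  rw [← coeff_map, this]
  simp

/-- Planes through both centers have the form `cross4 c O₁ O₂`. Fix a good pair `a₀, b₀`, write it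
in this form for two points `P₁, P₂` of its axis, and keep the resulting `c, c'`. The pair then
depends polynomially on the centers, and `θ` transports the good condition to a polynomial that is
nonzero at `(P₁, P₂)`. -/
theorem exists_generic_pencil {Φ : MvPolynomial (Fin 4) ℂ} (hΦ : Prime Φ) :
    ∃ G : MvPolynomial (Fin 4 ⊕ Fin 4) ℂ, G ≠ 0 ∧ ∀ O₁ O₂ : Fin 4 → ℂ,
      eval (Sum.elim O₁ O₂) G ≠ 0 → ∃ a b : Fin 4 → ℂ, LinearIndependent ℂ ![a, b] ∧
        a ∈ perp (Submodule.span ℂ {O₁, O₂}) ∧ b ∈ perp (Submodule.span ℂ {O₁, O₂}) ∧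
        LinearIndependent ℂ ![O₁, O₂] ∧ (alongLine a b Φ).Separable ∧ eval b Φ ≠ 0 := by
  obtain ⟨r, hr0, hr⟩ := exists_separable_alongLine hΦ
  have hmap : ∀ a b : Fin 4 → ℂ, evalPair a b (map C Φ) = eval b Φ := by
    intro a b
    rw [evalPair, RingHom.comp_apply, map_map]
    congr 1
    convert map_id Φ
    ext c
    simp
  -- One nonzero minor ensures that `a` and `b` are independent; this also forces the centers to be
  -- independent, since otherwise `cross4` vanishes.
  let m : PairRing 4 := C (X 0) * X 1 - C (X 1) * X 0
  have hm : ∀ a b : Fin 4 → ℂ, evalPair a b m = a 0 * b 1 - a 1 * b 0 := by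
    intro a b
    simp [evalPair, m]
  have hm0 : m ≠ 0 := by
    intro h
    have := hm ![1, 0, 0, 0] ![0, 1, 0, 0]
    rw [h] at this
    simp at this
  have hΦ0 : (map C Φ : PairRing 4) ≠ 0 := by
    rw [Ne, map_eq_zero_iff _ (map_injective _ (C_injective _ _))]
    exact hΦ.ne_zero
  have hli : ∀ a b : Fin 4 → ℂ, evalPair a b m ≠ 0 → LinearIndependent ℂ ![a, b] := by
    intro a b hab
    rw [hm] at hab
    rw [LinearIndependent.pair_iff]
    intro s t hst
    have h0 := congrFun hst 0
    have h1 := congrFun hst 1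
    simp only [Pi.add_apply, Pi.smul_apply, smul_eq_mul, Pi.zero_apply] at h0 h1
    constructor
    · refine (mul_eq_zero.mp ?_).resolve_right hab
      linear_combination b 1 * h0 - b 0 * h1
    · refine (mul_eq_zero.mp ?_).resolve_right hab
      linear_combination a 0 * h1 - a 1 * h0
  obtain ⟨a₀, b₀, hab⟩ := exists_evalPair_ne_zero (mul_ne_zero (mul_ne_zero hr0 hΦ0) hm0)
  have hli₀ := hli a₀ b₀ (right_ne_zero_of_mul (by rwa [map_mul] at hab))
  obtain ⟨P₁, hP₁, P₂, hP₂, hP, -⟩ := exists_basis_pair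
    (W := perp (Submodule.span ℂ {a₀, b₀})) (by
      have := finrank_perp (Submodule.span ℂ {a₀, b₀})
      rw [finrank_span_pair hli₀] at this
      omega)
  rw [mem_perp_span] at hP₁ hP₂
  obtain ⟨c, hc⟩ := exists_eq_cross4 (y := a₀) hP
    (by rw [dotProduct_comm]; exact hP₁ _ (by simp)) (by rw [dotProduct_comm]; exact hP₂ _ (by simp))
  obtain ⟨c', hc'⟩ := exists_eq_cross4 (y := b₀) hP
    (by rw [dotProduct_comm]; exact hP₁ _ (by simp)) (by rw [dotProduct_comm]; exact hP₂ _ (by simp))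
  let vec : (Fin 4 → ℂ) → Fin 4 → MvPolynomial (Fin 4 ⊕ Fin 4) ℂ := fun c =>
    cross4 (fun i => C (c i)) (fun i => X (Sum.inl i)) fun i => X (Sum.inr i)
  have hvec : ∀ (c O₁ O₂ : Fin 4 → ℂ), (fun i => eval (Sum.elim O₁ O₂) (vec c i)) =
      cross4 c O₁ O₂ := by
    intro c O₁ O₂
    rw [map_cross4]
    congr 1 <;> funext i <;> simp
  let θ : PairRing 4 →+* MvPolynomial (Fin 4 ⊕ Fin 4) ℂ :=
    eval₂Hom (eval₂Hom C (vec c)) (vec c')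
  have hθ : ∀ (O₁ O₂ : Fin 4 → ℂ) p,
      eval (Sum.elim O₁ O₂) (θ p) = evalPair (cross4 c O₁ O₂) (cross4 c' O₁ O₂) p := by
    intro O₁ O₂ p
    have : (eval (Sum.elim O₁ O₂)).comp θ = evalPair (cross4 c O₁ O₂) (cross4 c' O₁ O₂) := by
      rw [← hvec, ← hvec]
      refine MvPolynomial.ringHom_ext' (MvPolynomial.ringHom_ext' ?_ ?_) ?_
      · ext; simp [θ, evalPair]
      · intro i; simp [θ, evalPair]
      · intro i; simp [θ, evalPair]
    exact congrArg (fun φ => φ p) this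
  refine ⟨θ (r * map C Φ * m), fun h => ?_, fun O₁ O₂ h => ?_⟩
  · have := hθ P₁ P₂ (r * map C Φ * m)
    rw [h, map_zero, ← hc, ← hc'] at this
    exact hab this.symm
  · rw [hθ, map_mul, map_mul] at h
    have hli' := hli _ _ (right_ne_zero_of_mul h)
    have h' := left_ne_zero_of_mul h
    have hperp : ∀ c, cross4 c O₁ O₂ ∈ perp (Submodule.span ℂ {O₁, O₂}) := by
      intro c
      rw [mem_perp_span]
      rintro w (rfl | rfl)
      · exact cross4_dotProduct_middle _ _ _
      · exact cross4_dotProduct_right _ _ _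
    refine ⟨_, _, hli', hperp c, hperp c', ?_, hr _ _ (left_ne_zero_of_mul h'), ?_⟩
    · by_contra hdep
      have := hli'.ne_zero 0
      simp [cross4_eq_zero hdep] at this
    · rw [← hmap]
      exact right_ne_zero_of_mul h'

/-! ### Epipolar planes and the fundamental matrix -/

section TwoViews

variable {M M₁ M₂ : Matrix (Fin 3) (Fin 4) ℂ} {O O' O₁ O₂ : Fin 4 → ℂ} {e e₁ e₂ : Fin 3 → ℂ}

theorem IsEpipole.mem_pencil_iff (he : IsEpipole M O' e) {l : Fin 3 → ℂ} :
    l ∈ pencil e ↔ (Mᵀ *ᵥ l) ⬝ᵥ O' = 0 := by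
  obtain ⟨he0, c, rfl⟩ := he
  have hc : c ≠ 0 := by
    rintro rfl
    exact he0 (zero_smul _ _)
  change l ⬝ᵥ (c • (M *ᵥ O')) = 0 ↔ _
  rw [dotProduct_smul, smul_eq_zero, or_iff_right hc, Matrix.dotProduct_mulVec,
    Matrix.mulVec_transpose]

/-- The lines through the epipole correspond to the planes through both centers. -/
theorem IsEpipole.exists_pencil_equiv (he : IsEpipole M O' e) (hM : IsCamera M O) :
    ∃ N : pencil e ≃ₗ[ℂ] perp (Submodule.span ℂ {O, O'}),
      ∀ l, (N l : Fin 4 → ℂ) = Mᵀ *ᵥ (l : Fin 3 → ℂ) := by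
  have hmem : ∀ l : pencil e, Mᵀ *ᵥ (l : Fin 3 → ℂ) ∈ perp (Submodule.span ℂ {O, O'}) := by
    intro l
    rw [mem_perp_span]
    rintro w (rfl | rfl)
    · exact hM.transpose_mulVec_dotProduct _
    · exact he.mem_pencil_iff.mp l.2
  let f : pencil e →ₗ[ℂ] perp (Submodule.span ℂ {O, O'}) :=
    (Mᵀ.mulVecLin.comp (pencil e).subtype).codRestrict _ hmem
  refine ⟨LinearEquiv.ofBijective f ⟨fun l l' h => ?_, fun y => ?_⟩, fun l => rfl⟩
  · exact Subtype.ext (hM.transpose_mulVec_injective (congrArg Subtype.val h))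
  · have hy := mem_perp_span.mp y.2
    obtain ⟨l, hl⟩ := hM.exists_transpose_mulVec_eq (hy O (by simp))
    refine ⟨⟨l, he.mem_pencil_iff.mpr ?_⟩, Subtype.ext hl⟩
    rw [hl]
    exact hy O' (by simp)

theorem cross_mem_pencil (e p : Fin 3 → ℂ) : e ⨯₃ p ∈ pencil e := by
  change (e ⨯₃ p) ⬝ᵥ e = 0
  rw [dotProduct_comm, dot_self_cross]

theorem mem_span_of_cross_eq_zero {e p : Fin 3 → ℂ} (he : e ≠ 0) (h : e ⨯₃ p = 0) :
    p ∈ Submodule.span ℂ {e} := by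
  by_contra hp
  have hli : LinearIndependent ℂ ![e, p] := by
    refine (LinearIndependent.pair_iff' he).mpr fun c hc => hp ?_
    exact Submodule.mem_span_singleton.mpr ⟨c, hc⟩
  exact crossProduct_ne_zero_iff_linearIndependent.mpr hli h

/-- Comparing the factors at `q`, `p₀` and `q + p₀` makes them equal, because `T` is injective
modulo `e`. Vectors in `span {e, p₀}` are reached by adding `q₀`. -/
theorem eq_smul_of_forall_exists_smul {V W : Type*} [AddCommGroup V] [Module ℂ V]
    [AddCommGroup W] [Module ℂ W] (S T : V →ₗ[ℂ] W) {e p₀ q₀ : V}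
    (hT : ∀ v, T v = 0 → v ∈ Submodule.span ℂ {e}) (h0 : p₀ ∉ Submodule.span ℂ {e})
    (hq₀ : q₀ ∉ Submodule.span ℂ {e, p₀})
    (h : ∀ v, v ∉ Submodule.span ℂ {e} → ∃ c : ℂ, S v = c • T v) : ∃ c : ℂ, ∀ v, S v = c • T v := by
  obtain ⟨c, hc⟩ := h p₀ h0
  have key : ∀ q, q ∉ Submodule.span ℂ {e, p₀} → S q = c • T q := by
    intro q hq
    have hle : Submodule.span ℂ {e} ≤ Submodule.span ℂ {e, p₀} :=
      Submodule.span_mono (by simp)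
    have hp₀ : p₀ ∈ Submodule.span ℂ {e, p₀} := Submodule.subset_span (by simp)
    obtain ⟨c₁, h₁⟩ := h q fun hmem => hq (hle hmem)
    obtain ⟨c₂, h₂⟩ := h (q + p₀) fun hmem =>
      hq (by simpa using Submodule.sub_mem _ (hle hmem) hp₀)
    rw [map_add, map_add, h₁, hc] at h₂
    have hz : T ((c₁ - c₂) • q + (c - c₂) • p₀) = 0 := by
      rw [map_add, map_smul, map_smul]
      rw [← sub_eq_zero.mpr h₂]
      module
    have hmem := hT _ hz
    have h3 : c₁ = c₂ := by
      by_contra hne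
      have h4 := Submodule.sub_mem _ (hle hmem) (Submodule.smul_mem _ (c - c₂) hp₀)
      rw [add_sub_cancel_right] at h4
      exact hq ((Submodule.smul_mem_iff _ (sub_ne_zero.mpr hne)).mp h4)
    rw [h3, sub_self, zero_smul, zero_add] at hmem
    have h5 : c = c₂ := by
      by_contra hne
      exact h0 ((Submodule.smul_mem_iff _ (sub_ne_zero.mpr hne)).mp hmem)
    rw [h₁, h3, h5]
  refine ⟨c, fun v => ?_⟩
  by_cases hv : v ∈ Submodule.span ℂ {e, p₀}
  · have h1 := key (v + q₀) fun hmem => hq₀ (by simpa using Submodule.sub_mem _ hmem hv)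
    rw [map_add, map_add, key q₀ hq₀, smul_add] at h1
    exact add_right_cancel h1
  · exact key v hv

theorem exists_notMem_span_pair (u v : Fin 3 → ℂ) : ∃ w, w ∉ Submodule.span ℂ {u, v} := by
  by_contra! h
  have htop : Submodule.span ℂ (Set.range ![u, v]) = ⊤ := by
    rw [range_pair, eq_top_iff]
    exact fun w _ => h w
  have h2 := finrank_range_le_card (R := ℂ) ![u, v]
  rw [Set.finrank, htop, finrank_top] at h2
  simp at h2

/-- The line `F p` and the line joining `p` to the epipole have the same plane of sight. -/
theorem IsFundamentalMatrix.exists_smul (hM₁ : IsCamera M₁ O₁) (hM₂ : IsCamera M₂ O₂)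
    (he₁ : IsEpipole M₁ O₂ e₁) (hO : LinearIndependent ℂ ![O₁, O₂])
    {F : Matrix (Fin 3) (Fin 3) ℂ} (hF : IsFundamentalMatrix M₁ M₂ e₁ F) :
    ∃ κ : ℂ, κ ≠ 0 ∧ ∀ p, M₂ᵀ *ᵥ (F *ᵥ p) = κ • (M₁ᵀ *ᵥ (e₁ ⨯₃ p)) := by
  obtain ⟨R, hR⟩ := hM₁.exists_rightInverse
  have hMR : ∀ p, M₁ *ᵥ (R *ᵥ p) = p := fun p => by
    rw [Matrix.mulVec_mulVec, hR, Matrix.one_mulVec]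
  have hperp : ∀ p, p ∉ Submodule.span ℂ {e₁} → ∀ P, M₁ *ᵥ P ∈ Submodule.span ℂ {p} →
      (M₂ᵀ *ᵥ (F *ᵥ p)) ⬝ᵥ P = 0 := by
    intro p hp P hP
    rw [Matrix.mulVec_transpose, ← Matrix.dotProduct_mulVec]
    exact (hF p hp _).mp ⟨P, hP, rfl⟩
  have hMO₂ : M₁ *ᵥ O₂ ∈ Submodule.span ℂ {e₁} := by
    obtain ⟨he0, c, rfl⟩ := he₁
    have hc : c ≠ 0 := by
      rintro rfl
      exact he0 (zero_smul _ _)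
    exact Submodule.mem_span_singleton.mpr ⟨c⁻¹, by rw [smul_smul, inv_mul_cancel₀ hc, one_smul]⟩
  have hspan := finrank_span_pair hO
  have hT : ∀ p, M₁ᵀ *ᵥ (e₁ ⨯₃ p) = 0 → p ∈ Submodule.span ℂ {e₁} := fun p hp =>
    mem_span_of_cross_eq_zero he₁.1
      (hM₁.transpose_mulVec_injective (hp.trans (Matrix.mulVec_zero _).symm))
  have hTO : ∀ p, M₁ᵀ *ᵥ (e₁ ⨯₃ p) ∈ perp (Submodule.span ℂ {O₁, O₂}) := by
    intro p
    rw [mem_perp_span]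
    rintro w (rfl | rfl)
    · exact hM₁.transpose_mulVec_dotProduct _
    · exact he₁.mem_pencil_iff.mp (cross_mem_pencil _ _)
  have hex : ∀ p, p ∉ Submodule.span ℂ {e₁} →
      ∃ c : ℂ, M₂ᵀ *ᵥ (F *ᵥ p) = c • (M₁ᵀ *ᵥ (e₁ ⨯₃ p)) := by
    intro p hp
    -- Both planes contain the two centers and the point `R p` of the optical ray, which is off the
    -- baseline because `p` is not the epipole.
    refine exists_smul_eq_of_dotProduct_eq_zero (O := R *ᵥ p)
      (W := perp (Submodule.span ℂ {O₁, O₂})) ?_ ?_ (hTO p) ?_ (fun h => hp (hT p h)) ?_ ?_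
    · have := finrank_perp (Submodule.span ℂ {O₁, O₂})
      omega
    · rw [perp_perp]
      intro hmem
      obtain ⟨s, t, hst⟩ := Submodule.mem_span_pair.mp hmem
      apply hp
      rw [← hMR p, ← hst, Matrix.mulVec_add, Matrix.mulVec_smul, Matrix.mulVec_smul, hM₁.2.2,
        smul_zero, zero_add]
      exact Submodule.smul_mem _ _ hMO₂
    · rw [mem_perp_span]
      rintro w (rfl | rfl)
      · exact hperp p hp w (by rw [hM₁.2.2]; exact Submodule.zero_mem _)
      · exact hM₂.transpose_mulVec_dotProduct _
    · rw [Matrix.mulVec_transpose, ← Matrix.dotProduct_mulVec, hMR, dotProduct_comm,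
        dot_cross_self]
    · exact hperp p hp _ (by rw [hMR]; exact Submodule.mem_span_singleton_self p)
  obtain ⟨p₀, hp₀⟩ := exists_notMem_span_pair e₁ e₁
  rw [Set.pair_eq_singleton] at hp₀
  obtain ⟨q₀, hq₀⟩ := exists_notMem_span_pair e₁ p₀
  obtain ⟨κ, hκ⟩ := eq_smul_of_forall_exists_smul (M₂ᵀ.mulVecLin.comp F.mulVecLin)
    (M₁ᵀ.mulVecLin.comp (crossProduct e₁)) hT hp₀ hq₀ hex
  refine ⟨κ, ?_, hκ⟩
  rintro rfl
  -- If `κ = 0`, the ray of `p₀` would fill the second image; together with `O₂` it would fill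
  -- space, forcing `q₀` into `span {e₁, p₀}`.
  have hF0 : F *ᵥ p₀ = 0 := hM₂.transpose_mulVec_injective
    ((hκ p₀).trans ((zero_smul _ _).trans (Matrix.mulVec_zero _).symm))
  obtain ⟨P, hP, hPM⟩ := (hF p₀ hp₀ (M₂ *ᵥ (R *ᵥ q₀))).mpr (by rw [hF0, zero_dotProduct])
  have hker : R *ᵥ q₀ - P ∈ LinearMap.ker M₂.mulVecLin := by
    rw [LinearMap.mem_ker, map_sub, hPM]
    exact sub_self _
  rw [hM₂.ker_eq] at hker
  obtain ⟨t, ht⟩ := Submodule.mem_span_singleton.mp hker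
  apply hq₀
  have : q₀ = t • (M₁ *ᵥ O₂) + M₁ *ᵥ P := by
    rw [← Matrix.mulVec_smul, ht, ← Matrix.mulVec_add, sub_add_cancel, hMR]
  rw [this]
  refine Submodule.add_mem _ (Submodule.smul_mem _ _ ?_) ?_
  · exact Submodule.span_mono (by simp) hMO₂
  · exact Submodule.span_mono (by simp) hP

end TwoViews

/-! ### Orders of vanishing -/

theorem orderAlong_eq {n : ℕ} (φ : MvPolynomial (Fin n) ℂ) (l k : Fin n → ℂ) :
    orderAlong φ l k = emultiplicity Polynomial.X (alongLine l k φ) := rfl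

theorem emultiplicity_C_mul {c : ℂ} (hc : c ≠ 0) (p : Polynomial ℂ) :
    emultiplicity Polynomial.X (Polynomial.C c * p) = emultiplicity Polynomial.X p :=
  emultiplicity_eq_of_associated_right
    (associated_unit_mul_left p _ ((Ne.isUnit hc).map Polynomial.C))

theorem pointMultiplicity_eq_zero {n : ℕ} {φ : MvPolynomial (Fin n) ℂ} {l : Fin n → ℂ}
    (h : eval l φ ≠ 0) : pointMultiplicity φ l = 0 := by
  refine le_antisymm ((iInf_le _ 0).trans_eq ?_) zero_le
  rw [orderAlong_eq, emultiplicity_eq_zero, Polynomial.X_dvd_iff,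
    Polynomial.coeff_zero_eq_eval_zero, eval_alongLine]
  simpa using h

/-- A single direction with a simple zero bounds the infimum by one. -/
theorem pointMultiplicity_eq_one {n : ℕ} {φ : MvPolynomial (Fin n) ℂ} {l k : Fin n → ℂ}
    (h : eval l φ = 0) (hk : Squarefree (alongLine l k φ)) : pointMultiplicity φ l = 1 := by
  refine le_antisymm ((iInf_le _ k).trans ?_) (le_iInf fun k => ?_)
  · rw [orderAlong_eq]
    exact (squarefree_iff_emultiplicity_le_one _).mp hk _ |>.resolve_right Polynomial.not_isUnit_X
  · rw [orderAlong_eq, ← Nat.cast_one, ← pow_dvd_iff_le_emultiplicity, pow_one,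
      Polynomial.X_dvd_iff, Polynomial.coeff_zero_eq_eval_zero, eval_alongLine]
    simpa using h

theorem squarefree_comp_X_add_C {p : Polynomial ℂ} (hp : Squarefree p) (s : ℂ) :
    Squarefree (p.comp (Polynomial.X + Polynomial.C s)) := by
  intro q hq
  have h : q.comp (Polynomial.X - Polynomial.C s) * q.comp (Polynomial.X - Polynomial.C s) ∣ p := by
    obtain ⟨r, hr⟩ := hq
    refine ⟨r.comp (Polynomial.X - Polynomial.C s), ?_⟩
    rw [← Polynomial.mul_comp, ← Polynomial.mul_comp, ← hr, Polynomial.comp_assoc]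
    simp
  have hu := hp _ h
  have := hu.map (Polynomial.compRingHom (Polynomial.X + Polynomial.C s))
  rw [Polynomial.coe_compRingHom_apply, Polynomial.comp_assoc] at this
  simpa using this

/-- Every common zero in a pencil transverse to a hypersurface is a simple point. -/
theorem exists_squarefree_alongLine {D : ℕ} {Φ : MvPolynomial (Fin 4) ℂ} (hΦ : Φ.IsHomogeneous D)
    {a b h : Fin 4 → ℂ} (hsq : Squarefree (alongLine a b Φ)) (hb : eval b Φ ≠ 0)
    (hh : h ∈ Submodule.span ℂ {a, b}) (hh0 : h ≠ 0) (hh' : eval h Φ = 0) :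
    ∃ k ∈ Submodule.span ℂ {a, b}, Squarefree (alongLine h k Φ) := by
  obtain ⟨x, y, rfl⟩ := Submodule.mem_span_pair.mp hh
  have hx : x ≠ 0 := by
    rintro rfl
    rw [zero_smul, zero_add] at hh' hh0
    rw [eval_smul_of_isHomogeneous hΦ] at hh'
    have hy : y ≠ 0 := by
      rintro rfl
      exact hh0 (zero_smul _ _)
    exact mul_ne_zero (pow_ne_zero _ hy) hb hh'
  -- With this direction, `h + t k = x (a + (t + y / x) b)`, so the restriction is a translate of
  -- the original one up to a scalar. Here `x ≠ 0` because `Φ` does not vanish at `b`.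
  refine ⟨x • b, Submodule.smul_mem _ _ (Submodule.subset_span (by simp)), ?_⟩
  have heq : alongLine (x • a + y • b) (x • b) Φ =
      Polynomial.C (x ^ D) * (alongLine a b Φ).comp (Polynomial.X + Polynomial.C (x⁻¹ * y)) := by
    refine Polynomial.funext fun t => ?_
    rw [Polynomial.eval_mul, Polynomial.eval_C, Polynomial.eval_comp, eval_alongLine,
      eval_alongLine, ← eval_smul_of_isHomogeneous hΦ]
    congr 2
    simp only [Polynomial.eval_add, Polynomial.eval_X, Polynomial.eval_C, smul_add, smul_smul,
      add_smul]
    have : x * (x⁻¹ * y) = y := by field_simp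
    rw [this, mul_comm t x]
    abel
  rw [heq]
  exact (squarefree_comp_X_add_C hsq _).squarefree_of_dvd
    (associated_unit_mul_left _ _ ((Ne.isUnit (pow_ne_zero D hx)).map Polynomial.C)).dvd

/-! ### Transversal pencils seen in one image -/

section Views

variable {X : Set (Proj 4)} {M : Matrix (Fin 3) (Fin 4) ℂ} {O O' a b : Fin 4 → ℂ}
  {Φ : MvPolynomial (Fin 4) ℂ} {D : ℕ}

/-- Planes through the center come from image lines, so the transversal pencil is a line in the dual
plane; `Φ b ≠ 0` keeps the full degree on it. -/
theorem IsCamera.squarefree_pullback (hM : IsCamera M O) (hΦ : Φ.IsHomogeneous D)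
    (ha : a ⬝ᵥ O = 0) (hb : b ⬝ᵥ O = 0) (hsq : Squarefree (alongLine a b Φ))
    (hbΦ : eval b Φ ≠ 0) : Squarefree (pullback Mᵀ Φ) := by
  obtain ⟨α, rfl⟩ := hM.exists_transpose_mulVec_eq ha
  obtain ⟨β, rfl⟩ := hM.exists_transpose_mulVec_eq hb
  rw [← alongLine_pullback] at hsq
  have hhom : (pullback Mᵀ Φ).IsHomogeneous D := by
    have := hΦ.aeval (fun i => ∑ k, C (Mᵀ i k) * X k) (n := 1) fun i =>
      IsHomogeneous.sum _ _ _ fun k _ => (isHomogeneous_X ℂ k).C_mul _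
    rwa [one_mul] at this
  rw [← eval_pullback] at hbΦ
  refine squarefree_of_squarefree_alongLine (fun h => hbΦ (by rw [h, map_zero])) hsq ?_
  refine hhom.totalDegree_le.trans (Polynomial.le_natDegree_of_ne_zero ?_)
  rwa [coeff_alongLine hhom]

theorem exists_eq_C_mul_of_span_eq {n : ℕ} {φ ψ : MvPolynomial (Fin n) ℂ}
    (h : Ideal.span {φ} = Ideal.span {ψ}) : ∃ c : ℂ, c ≠ 0 ∧ φ = C c * ψ := by
  obtain ⟨u, hu⟩ := (Ideal.span_singleton_eq_span_singleton.mp h).symm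
  obtain ⟨c, hc, hcu⟩ := MvPolynomial.isUnit_iff_eq_C_of_isReduced.mp u.isUnit
  refine ⟨c, hc.ne_zero, ?_⟩
  rw [← hu, hcu, mul_comm]

theorem mem_coords_dualCurve_iff {φ : MvPolynomial (Fin 3) ℂ} {Y : Set (Proj 3)}
    (hφ : IsDefiningPolynomial φ (dualCurve Y)) {l : Fin 3 → ℂ} :
    l ∈ coords (dualCurve Y) ↔ l ≠ 0 ∧ eval l φ = 0 := by
  have h : Ideal.span {φ} = idealOf (tangentLines Y) := hφ.trans idealOf_zariskiClosure
  rw [dualCurve, mem_coords_zariskiClosure]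
  refine and_congr_right fun _ => ⟨fun H => H φ (h ▸ Ideal.mem_span_singleton_self φ), ?_⟩
  intro hl f hf
  rw [← h, Ideal.mem_span_singleton] at hf
  obtain ⟨q, rfl⟩ := hf
  rw [map_mul, hl, zero_mul]

/-- On the pencil of lines through the epipole, the multiplicity of a point of the dual curve is
one at every zero. -/
theorem pointMultiplicity_of_mem_pencil (hM : IsCamera M O) {e : Fin 3 → ℂ}
    (he : IsEpipole M O' e) (hΦ : Φ.IsHomogeneous D)
    (hab : Submodule.span ℂ {a, b} = perp (Submodule.span ℂ {O, O'}))
    (hsq : Squarefree (alongLine a b Φ)) (hb : eval b Φ ≠ 0) {φ : MvPolynomial (Fin 3) ℂ} {c : ℂ}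
    (hc : c ≠ 0) (hφ : φ = C c * pullback Mᵀ Φ) {l : Fin 3 → ℂ} (hl : l ∈ pencil e) (hl0 : l ≠ 0)
    (h0 : eval l φ = 0) : pointMultiplicity φ l = 1 := by
  obtain ⟨N, hN⟩ := he.exists_pencil_equiv hM
  have hMl : Mᵀ *ᵥ l ∈ Submodule.span ℂ {a, b} := by
    rw [hab, ← hN ⟨l, hl⟩]
    exact (N ⟨l, hl⟩).2
  have hMl0 : Mᵀ *ᵥ l ≠ 0 := fun h =>
    hl0 (hM.transpose_mulVec_injective (h.trans (Matrix.mulVec_zero _).symm))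
  have hzero : eval (Mᵀ *ᵥ l) Φ = 0 := by
    rw [hφ, map_mul, eval_C, eval_pullback] at h0
    exact (mul_eq_zero.mp h0).resolve_left hc
  obtain ⟨k, hk, hksq⟩ := exists_squarefree_alongLine hΦ hsq hb hMl hMl0 hzero
  rw [hab] at hk
  obtain ⟨m, hm⟩ := hM.exists_transpose_mulVec_eq (mem_perp_span.mp hk O (by simp))
  refine pointMultiplicity_eq_one h0 (k := m) ?_
  have : alongLine l m φ = Polynomial.C c * alongLine (Mᵀ *ᵥ l) k Φ := by
    rw [hφ, map_mul, alongLine_pullback, hm]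
    congr 1
    exact (alongLine l m).commutes c
  rw [this]
  exact hksq.squarefree_of_dvd
    (associated_unit_mul_left _ _ ((Ne.isUnit hc).map Polynomial.C)).dvd

end Views

/-- All comparisons rest on `hline`: both dual curves are sections of `Φ`, and corresponding lines
have proportional planes of sight. -/
theorem kruppa_of_pencil {X : Set (Proj 4)} {M₁ M₂ : Matrix (Fin 3) (Fin 4) ℂ}
    {O₁ O₂ a b : Fin 4 → ℂ} {Φ : MvPolynomial (Fin 4) ℂ} {D : ℕ} (hΦ : Φ.IsHomogeneous D)
    (hM₁ : IsCamera M₁ O₁) (hM₂ : IsCamera M₂ O₂) (hO : LinearIndependent ℂ ![O₁, O₂])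
    (hab : Submodule.span ℂ {a, b} = perp (Submodule.span ℂ {O₁, O₂}))
    (hsq : Squarefree (alongLine a b Φ)) (hb : eval b Φ ≠ 0)
    (h₁ : Ideal.span {pullback M₁ᵀ Φ} = idealOf (dualCurve (imageCurve M₁ X)))
    (h₂ : Ideal.span {pullback M₂ᵀ Φ} = idealOf (dualCurve (imageCurve M₂ X)))
    {φ₁ φ₂ : MvPolynomial (Fin 3) ℂ}
    (hφ₁ : IsDefiningPolynomial φ₁ (dualCurve (imageCurve M₁ X)))
    (hφ₂ : IsDefiningPolynomial φ₂ (dualCurve (imageCurve M₂ X)))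
    {e₁ e₂ : Fin 3 → ℂ} {F : Matrix (Fin 3) (Fin 3) ℂ} (he₁ : IsEpipole M₁ O₂ e₁)
    (he₂ : IsEpipole M₂ O₁ e₂) (hF : IsFundamentalMatrix M₁ M₂ e₁ F) :
    (∃ c : ℂ, c ≠ 0 ∧ ∀ p : Fin 3 → ℂ, eval (F *ᵥ p) φ₂ = c * eval (e₁ ⨯₃ p) φ₁) ∧
      EpipolarTangentsCorrespond (imageCurve M₁ X) (imageCurve M₂ X) φ₁ φ₂ e₁ e₂ F := by
  obtain ⟨c₁, hc₁, hφc₁⟩ := exists_eq_C_mul_of_span_eq (hφ₁.trans h₁.symm)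
  obtain ⟨c₂, hc₂, hφc₂⟩ := exists_eq_C_mul_of_span_eq (hφ₂.trans h₂.symm)
  obtain ⟨κ, hκ, hκF⟩ := hF.exists_smul hM₁ hM₂ he₁ hO
  obtain ⟨N₁, hN₁⟩ := he₁.exists_pencil_equiv hM₁
  obtain ⟨N₂, hN₂⟩ := he₂.exists_pencil_equiv hM₂
  have hpair : ({O₂, O₁} : Set (Fin 4 → ℂ)) = {O₁, O₂} := Set.pair_comm _ _
  have hline : ∀ l l' k k' : Fin 3 → ℂ, M₂ᵀ *ᵥ l' = κ • (M₁ᵀ *ᵥ l) →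
      M₂ᵀ *ᵥ k' = κ • (M₁ᵀ *ᵥ k) →
      alongLine l' k' φ₂ = Polynomial.C (c₂ * κ ^ D * c₁⁻¹) * alongLine l k φ₁ := by
    intro l l' k k' hl hk
    have hC : ∀ (l k : Fin 3 → ℂ) c, alongLine l k (C c) = Polynomial.C c :=
      fun l k => (alongLine l k).commutes
    rw [hφc₁, hφc₂, map_mul (alongLine l' k'), map_mul (alongLine l k), alongLine_pullback,
      alongLine_pullback, hl, hk, alongLine_smul hΦ, hC, hC, ← mul_assoc, ← mul_assoc, ← Polynomial.C_mul, ← Polynomial.C_mul,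
      inv_mul_cancel_right₀ hc₁]
  have hc : c₂ * κ ^ D * c₁⁻¹ ≠ 0 := mul_ne_zero (mul_ne_zero hc₂ (pow_ne_zero _ hκ))
    (inv_ne_zero hc₁)
  have heval : ∀ l l' : Fin 3 → ℂ, M₂ᵀ *ᵥ l' = κ • (M₁ᵀ *ᵥ l) →
      eval l' φ₂ = c₂ * κ ^ D * c₁⁻¹ * eval l φ₁ := by
    intro l l' hl
    have h := congrArg (Polynomial.eval 0) (hline l l' 0 0 hl (by simp))
    rwa [Polynomial.eval_mul, Polynomial.eval_C, eval_alongLine, eval_alongLine, smul_zero,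
      add_zero, add_zero] at h
  refine ⟨⟨_, hc, fun p => heval _ _ (hκF p)⟩, ?_⟩
  let E : perp (Submodule.span ℂ {O₁, O₂}) ≃ₗ[ℂ] perp (Submodule.span ℂ {O₂, O₁}) :=
    LinearEquiv.ofEq _ _ (by rw [hpair])
  -- The factor `κ` makes `h (e₁ × p)` equal to `F p` and not merely proportional to it; `E` only
  -- exchanges the two centers.
  let h : pencil e₁ ≃ₗ[ℂ] pencil e₂ :=
    ((N₁.trans (LinearEquiv.smulOfNeZero ℂ _ κ hκ)).trans E).trans N₂.symm
  have hh : ∀ l, M₂ᵀ *ᵥ (h l : Fin 3 → ℂ) = κ • (M₁ᵀ *ᵥ (l : Fin 3 → ℂ)) := by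
    intro l
    rw [← hN₂, ← hN₁]
    simp [h, E]
  refine ⟨h, fun l p hlp => ?_, fun l hl0 => ?_⟩
  · apply hM₂.transpose_mulVec_injective
    rw [hh, hκF, hlp]
  have hl0' : (l : Fin 3 → ℂ) ≠ 0 := fun h => hl0 (Subtype.ext h)
  have hhl0' : (h l : Fin 3 → ℂ) ≠ 0 := fun h' =>
    hl0 (h.map_eq_zero_iff.mp (Subtype.ext h'))
  have hiff : eval (l : Fin 3 → ℂ) φ₁ = 0 ↔ eval (h l : Fin 3 → ℂ) φ₂ = 0 := by
    rw [heval _ _ (hh l), mul_eq_zero, or_iff_right hc]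
  refine ⟨?_, ?_, fun k => ?_⟩
  · rw [mem_coords_dualCurve_iff hφ₁, mem_coords_dualCurve_iff hφ₂, hiff]
    simp only [hl0', hhl0', ne_eq, not_false_eq_true]
  -- Point multiplicity involves directions outside the pencil, where `hline` says nothing;
  -- transversality makes both multiplicities one at a zero.
  · by_cases h0 : eval (l : Fin 3 → ℂ) φ₁ = 0
    · rw [pointMultiplicity_of_mem_pencil hM₁ he₁ hΦ hab hsq hb hc₁ hφc₁ l.2 hl0' h0,
        pointMultiplicity_of_mem_pencil hM₂ he₂ hΦ (by rw [hab, hpair]) hsq hb hc₂ hφc₂ (h l).2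
          hhl0' (hiff.mp h0)]
    · rw [pointMultiplicity_eq_zero h0, pointMultiplicity_eq_zero fun h' => h0 (hiff.mpr h')]
  · rw [orderAlong_eq, orderAlong_eq, hline _ _ _ _ (hh l) (hh k), emultiplicity_C_mul hc]

end Kruppa

end

theorem mainTheorem2 (X : Set (Kruppa.Proj 4)) (hX : Kruppa.IsSmoothSpaceCurve X)
    (hnp : Kruppa.IsNonPlanar X) :
    Kruppa.ForGenericCenters fun O₁ O₂ =>
      ∀ M₁ M₂ : Matrix (Fin 3) (Fin 4) ℂ, Kruppa.IsCamera M₁ O₁ → Kruppa.IsCamera M₂ O₂ →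
        (∃ φ₁, Kruppa.IsDefiningPolynomial φ₁ (Kruppa.dualCurve (Kruppa.imageCurve M₁ X))) ∧
        (∃ φ₂, Kruppa.IsDefiningPolynomial φ₂ (Kruppa.dualCurve (Kruppa.imageCurve M₂ X))) ∧
        ∀ φ₁ φ₂ : MvPolynomial (Fin 3) ℂ,
          Kruppa.IsDefiningPolynomial φ₁ (Kruppa.dualCurve (Kruppa.imageCurve M₁ X)) →
          Kruppa.IsDefiningPolynomial φ₂ (Kruppa.dualCurve (Kruppa.imageCurve M₂ X)) →
          ∀ (e₁ e₂ : Fin 3 → ℂ) (F : Matrix (Fin 3) (Fin 3) ℂ),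
            Kruppa.IsEpipole M₁ O₂ e₁ → Kruppa.IsEpipole M₂ O₁ e₂ →
            Kruppa.IsFundamentalMatrix M₁ M₂ e₁ F →
            (∃ c : ℂ, c ≠ 0 ∧ ∀ p : Fin 3 → ℂ,
              MvPolynomial.eval (F *ᵥ p) φ₂ = c * MvPolynomial.eval (e₁ ⨯₃ p) φ₁) ∧
            Kruppa.EpipolarTangentsCorrespond (Kruppa.imageCurve M₁ X) (Kruppa.imageCurve M₂ X)
              φ₁ φ₂ e₁ e₂ F := by
  open Kruppa in
  obtain ⟨Φ, hprime, hΦ⟩ := hX.exists_dualIdeal_eq_span hnp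
  have hhom := IsSmoothSpaceCurve.isHomogeneous_of_dualIdeal_eq_span hprime hΦ
  obtain ⟨G, hG0, hG⟩ := exists_generic_pencil hprime
  obtain ⟨g, hg0, hg⟩ := hX.exists_vanishing_on_tangents
  have hrename : ∀ f : Fin 4 → Fin 4 ⊕ Fin 4, Function.Injective f →
      MvPolynomial.rename f g ≠ 0 := fun f hf => by
    rwa [Ne, map_eq_zero_iff _ (MvPolynomial.rename_injective f hf)]
  -- `G` secures a transversal pencil; the two copies of `g` keep each center off the tangent lines
  -- of `X`.
  refine ⟨G * MvPolynomial.rename Sum.inl g * MvPolynomial.rename Sum.inr g,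
    mul_ne_zero (mul_ne_zero hG0 (hrename _ Sum.inl_injective)) (hrename _ Sum.inr_injective), ?_⟩
  intro O₁ O₂ _ _ hgen M₁ M₂ hM₁ hM₂
  rw [map_mul, map_mul, MvPolynomial.eval_rename, MvPolynomial.eval_rename, Sum.elim_comp_inl,
    Sum.elim_comp_inr] at hgen
  have hO₁ : ∀ x ∈ coords X, O₁ ∉ perp (conormal X x) := fun x hx h =>
    right_ne_zero_of_mul (left_ne_zero_of_mul hgen) (hg x hx _ h)
  have hO₂ : ∀ x ∈ coords X, O₂ ∉ perp (conormal X x) := fun x hx h =>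
    right_ne_zero_of_mul hgen (hg x hx _ h)
  obtain ⟨a, b, hab, ha, hb, hO, hsep, hbΦ⟩ := hG O₁ O₂
    (left_ne_zero_of_mul (left_ne_zero_of_mul hgen))
  have hsq := hsep.squarefree
  have h₁ := hX.idealOf_dualCurve hM₁ hO₁ hΦ
    (hM₁.squarefree_pullback hhom (mem_perp_span.mp ha _ (by simp))
      (mem_perp_span.mp hb _ (by simp)) hsq hbΦ)
  have h₂ := hX.idealOf_dualCurve hM₂ hO₂ hΦ
    (hM₂.squarefree_pullback hhom (mem_perp_span.mp ha _ (by simp))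
      (mem_perp_span.mp hb _ (by simp)) hsq hbΦ)
  have hspan : Submodule.span ℂ {a, b} = perp (Submodule.span ℂ {O₁, O₂}) := by
    refine Submodule.eq_of_le_of_finrank_le ?_ ?_
    · rw [Submodule.span_le]
      rintro _ (rfl | rfl) <;> assumption
    · have := finrank_perp (Submodule.span ℂ {O₁, O₂})
      rw [finrank_span_pair hO] at this
      rw [finrank_span_pair hab]
      omega
  exact ⟨⟨_, h₁⟩, ⟨_, h₂⟩, fun φ₁ φ₂ hφ₁ hφ₂ e₁ e₂ F he₁ he₂ hF =>
    kruppa_of_pencil hhom hM₁ hM₂ hO hspan hsq hbΦ h₁ h₂ hφ₁ hφ₂ he₁ he₂ hF⟩
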